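/- Let $K$ be a finitely generated field of characteristic $0$ with algebraic closure $\overline K$, and let $U:\mathbb Z\to K$ be a non-zero linear recurrence sequence, satisfying $U(n+m)=a_{m-1}U(n+m-1)+\cdots+a_0U(n)$ for all $n\in\mathbb Z$, where $m\ge 1$, $a_i\in K$ and $a_0\ne 0$, with Binet expansion $$U(n)=f_1(n)\lambda_1^n+\cdots+f_s(n)\lambda_s^n\qquad(n\in\mathbb Z),\qquad s\ge 2,$$ where $\lambda_1,\dots,\lambda_s\in K$ are the distinct roots of the characteristic polynomial $X^m-a_{m-1}X^{m-1}-\cdots-a_0$ and $f_1,\dots,f_s\in K[X]$. Assume that $U$ is non-degenerate, that is, $\lambda_i/\lambda_j$ is not a root of unity for $i\ne j$. Let $d=[K_{\mathrm{ab}}:\mathbb Q]$, where $K_{\mathrm{ab}}$ is the largest subfield of $K$ that is an abelian extension of $\mathbb Q$. Let the Chevalley–Bass number $\Lambda$ of $K$ be the smallest positive integer such that, for every $n\ge 1$, each $\alpha\in K$ which is a $\Lambda n$-th power in $K(\zeta_{\Lambda n})$ is an $n$-th power in $K$ (here $\zeta_k$ is a primitive $k$-th root of unity). For $\alpha\in K^\times$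 let the Kummer exponent $\varrho_K(\alpha)$ be the largest positive integer $n$ such that $\alpha\xi$ is an $n$-th power in $K$ for some root of unity $\xi\in K$, and put $\rho=\gcd\{\varrho_K(\lambda_i/\lambda_j):1\le i<j\le s\}$. Then $d$, $\Lambda$ and all $\varrho_K(\lambda_i/\lambda_j)$ with $i\ne j$ are well defined and finite. Let $a\in\mathbb Q$, let $\xi_1,\dots,\xi_s\in\overline K$ be roots of unity, and suppose that for some determinations $\lambda_1^a,\dots,\lambda_s^a\in\overline K$ of the rational powers $$\xi_1f_1(a)\lambda_1^a+\cdots+\xi_sf_s(a)\lambda_s^a=0,\qquad\text{while}\qquad \sum_{i\in I}\xi_if_i(a)\lambda_i^a\ne 0\quad\text{for all }\varnothing\subsetneq I\subsetneq\{1,\dots,s\}$$ (so $a$ is a primitive twisted rational zero of $U$). Then: 1. the denominator of $a$ divides $\Lambda\rho$; in particular it is effectively bounded in terms of $d$ and $\rho$: it is at most $B(d,\rho)$, where $B$ is a computable function independent of all the data; 2. the orders of all the roots of unity $\xi_i/\xi_j$ are effectively bounded in terms of $d$, $\rho$ and $s$: they are at most $C(d,\rho,s)$, where $C$ is a computable function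 independent of all the data. -/

import Mathlib

open Polynomial

universe u v

/-- `U : ℤ → K` is a two-sided linear recurrence sequence satisfying the recurrence `E`, that is,
`U (n + m) = a_{m-1} U (n + m - 1) + ⋯ + a_0 U n` for all integers `n`, with `a_0 ≠ 0`. -/
def IsTwoSidedLRS {K : Type*} [Field K] (E : LinearRecurrence K) (U : ℤ → K) : Prop :=
  (∃ h : 0 < E.order, E.coeffs ⟨0, h⟩ ≠ 0) ∧
    ∀ n : ℤ, U (n + (E.order : ℤ)) = ∑ i : Fin E.order, E.coeffs i * U (n + ((i : ℕ) : ℤ))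

/-- `U n = f_1(n) λ_1 ^ n + ⋯ + f_s(n) λ_s ^ n` is a Binet expansion, over the field `K`, of the
linear recurrence sequence `U`: the `λ_i` are the distinct roots of the characteristic polynomial
of a recurrence satisfied by `U` (all of them lie in `K`), and the `f_i` are polynomials over
`K`. -/
structure IsBinetExpansion {K : Type*} [Field K] {s : ℕ} (U : ℤ → K) (lam : Fin s → K)
    (f : Fin s → K[X]) : Prop where
  exists_recurrence : ∃ E : LinearRecurrence K, IsTwoSidedLRS E U ∧ E.charPoly.Splits ∧
    ∀ x : K, E.charPoly.IsRoot x ↔ ∃ i, lam i = x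
  injective : Function.Injective lam
  eq_sum : ∀ n : ℤ, U n = ∑ i, (f i).eval (n : K) * lam i ^ n

/-- A non-zero linear recurrence sequence with roots `λ_1, …, λ_s` is non-degenerate if no ratio
`λ_i / λ_j` with `i ≠ j` is a root of unity. -/
def IsNonDegenerate {K : Type*} [Field K] {s : ℕ} (U : ℤ → K) (lam : Fin s → K) : Prop :=
  U ≠ 0 ∧ ∀ i j, i ≠ j → ¬ IsOfFinOrder (lam i / lam j)

/-- `x` is a determination of the rational power `α ^ a`: writing `a = k / ℓ` in lowest terms with
`ℓ > 0`, it is the `k`-th power of an `ℓ`-th root of `α`. -/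
def IsRatPow {L : Type*} [Field L] (α : L) (a : ℚ) (x : L) : Prop :=
  ∃ θ : L, θ ^ a.den = α ∧ x = θ ^ a.num

/-- The `i`-th term `ξ_i f_i(a) λ_i ^ a`, where `p i` is the chosen determination of
`λ_i ^ a`. -/
noncomputable def twistedTerm {K L : Type*} [Field K] [Field L] [Algebra K L] {s : ℕ}
    (f : Fin s → K[X]) (a : ℚ) (ξ p : Fin s → L) (i : Fin s) : L :=
  ξ i * algebraMap K L ((f i).eval (a : K)) * p i

/-- The rational number `a` is a twisted rational zero of the sequence with Binet data `lam`, `f`,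
witnessed by the roots of unity `ξ_i` and the determinations `p i` of `λ_i ^ a`. -/
structure IsTwistedRationalZero {K L : Type*} [Field K] [Field L] [Algebra K L] {s : ℕ}
    (lam : Fin s → K) (f : Fin s → K[X]) (a : ℚ) (ξ p : Fin s → L) : Prop where
  root_of_unity : ∀ i, IsOfFinOrder (ξ i)
  determination : ∀ i, IsRatPow (algebraMap K L (lam i)) a (p i)
  sum_eq_zero : ∑ i, twistedTerm f a ξ p i = 0

/-- A twisted rational zero is primitive if no proper non-empty sub-sum vanishes. -/
structure IsPrimitiveTwistedRationalZero {K L : Type*} [Field K] [Field L] [Algebra K L] {s : ℕ}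
    (lam : Fin s → K) (f : Fin s → K[X]) (a : ℚ) (ξ p : Fin s → L) : Prop
    extends IsTwistedRationalZero lam f a ξ p where
  no_subsum : ∀ I : Finset (Fin s), I.Nonempty → I ≠ Finset.univ →
    ∑ i ∈ I, twistedTerm f a ξ p i ≠ 0

/-- The positive integers `Λ` such that, for all `n ≥ 1`, every `α ∈ K` which is a `Λ n`-th power
in `K(ζ_{Λ n})` is an `n`-th power in `K`. -/
def chevalleyBassSet (K : Type*) [Field K] : Set ℕ :=
  {Λ | 0 < Λ ∧ ∀ n : ℕ, 0 < n → ∀ α : K,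
    (∃ β : CyclotomicField (Λ * n) K, β ^ (Λ * n) = algebraMap K _ α) → ∃ γ : K, γ ^ n = α}

/-- The Chevalley–Bass number of `K`: the least element of `chevalleyBassSet K`. -/
noncomputable def chevalleyBassNumber (K : Type*) [Field K] : ℕ :=
  sInf (chevalleyBassSet K)

/-- The positive integers `n` such that `α ξ` is an `n`-th power in `K` for some root of unity
`ξ ∈ K`. -/
def kummerSet {K : Type*} [Field K] (α : K) : Set ℕ :=
  {n | 0 < n ∧ ∃ ξ β : K, IsOfFinOrder ξ ∧ α * ξ = β ^ n}

/-- The Kummer exponent of `α` in `K`: the greatest element of `kummerSet α`. -/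
noncomputable def kummerExponent {K : Type*} [Field K] (α : K) : ℕ :=
  sSup (kummerSet α)

/-- The gcd of the Kummer exponents of the ratios `λ_i / λ_j` for `i < j`. -/
noncomputable def kummerGcd {K : Type*} [Field K] {s : ℕ} (lam : Fin s → K) : ℕ :=
  (Finset.univ.filter fun q : Fin s × Fin s => q.1 < q.2).gcd
    fun q => kummerExponent (lam q.1 / lam q.2)

/-- The maximal abelian subextension of `K / k`: the compositum of all subextensions of `K / k` that
are abelian Galois extensions of `k`. -/
noncomputable def maxAbelianSubextension (k K : Type*) [Field k] [Field K] [Algebra k K] :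
    IntermediateField k K :=
  sSup {F | IsAbelianGalois k F}

/-- `maxAbelianSubextension k K` is the greatest subextension of `K / k` that is abelian over
`k`. -/
theorem isGreatest_maxAbelianSubextension (k K : Type*) [Field k] [Field K] [Algebra k K] :
    IsGreatest {F : IntermediateField k K | IsAbelianGalois k F} (maxAbelianSubextension k K) := by
  have hle : ∀ F : IntermediateField k K, IsAbelianGalois k F → F ≤ maxAbelianSubextension k K :=
    fun F hF => le_sSup hF
  refine ⟨?_, fun F hF => hle F hF⟩
  have hF : ∀ F : {F : IntermediateField k K | IsAbelianGalois k F}, IsAbelianGalois k F.1 :=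
    fun F => F.2
  have hn : Normal k (maxAbelianSubextension k K) := by
    rw [maxAbelianSubextension, sSup_eq_iSup']
    exact IntermediateField.normal_iSup k K
      (fun F : {F : IntermediateField k K | IsAbelianGalois k F} => F.1)
      (h := fun F => (hF F).toIsGalois.to_normal)
  have hs : Algebra.IsSeparable k (maxAbelianSubextension k K) := by
    rw [maxAbelianSubextension, sSup_eq_iSup']
    exact IntermediateField.isSeparable_iSup
      (t := fun F : {F : IntermediateField k K | IsAbelianGalois k F} => F.1)
      (h := fun F => (hF F).toIsGalois.to_isSeparable)
  have hg : IsGalois k (maxAbelianSubextension k K) := { }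
  refine { is_comm := ⟨fun σ τ => ?_⟩ }
  -- the elements of the compositum on which the two automorphisms commute
  let S : IntermediateField k (maxAbelianSubextension k K) :=
    { AlgHom.equalizer (σ * τ).toAlgHom (τ * σ).toAlgHom with
      inv_mem' := fun x hx => by
        have hx' : (σ * τ) x = (τ * σ) x := hx
        change (σ * τ) x⁻¹ = (τ * σ) x⁻¹
        rw [map_inv₀, map_inv₀, hx'] }
  have hS : maxAbelianSubextension k K ≤ IntermediateField.lift S := by
    refine sSup_le fun F hF x hx => ?_
    have hF' : IsAbelianGalois k F := hF
    have hFM := hle F hF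
    refine (IntermediateField.mem_lift (⟨x, hFM hx⟩ : maxAbelianSubextension k K)).2 ?_
    change (σ * τ) _ = (τ * σ) _
    let _ : Algebra F (maxAbelianSubextension k K) :=
      (IntermediateField.inclusion hFM).toRingHom.toAlgebra
    have ht : IsScalarTower k F (maxAbelianSubextension k K) :=
      IsScalarTower.of_algebraMap_eq fun q => rfl
    have e : (⟨x, hFM hx⟩ : maxAbelianSubextension k K) = algebraMap F _ ⟨x, hx⟩ := rfl
    have hc : σ.restrictNormal F * τ.restrictNormal F
        = τ.restrictNormal F * σ.restrictNormal F := hF'.is_comm.comm _ _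
    rw [e, AlgEquiv.mul_apply, AlgEquiv.mul_apply, ← AlgEquiv.restrictNormal_commutes,
      ← AlgEquiv.restrictNormal_commutes, ← AlgEquiv.restrictNormal_commutes,
      ← AlgEquiv.restrictNormal_commutes, ← AlgEquiv.mul_apply, ← AlgEquiv.mul_apply, hc]
  ext x
  have h : (σ * τ) x = (τ * σ) x := (IntermediateField.mem_lift x).1 (hS x.2)
  exact congrArg Subtype.val h

/-- The degree over `k` of the maximal abelian subextension of `K / k`. It is positive exactly when
that degree is finite. -/
noncomputable def maxAbelianDegree (k K : Type*) [Field k] [Field K] [Algebra k K] : ℕ :=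
  Module.finrank k (maxAbelianSubextension k K)

/-! ### Eigenvectors of a field automorphism -/

/-! Everything rests on one principle: if a field endomorphism multiplies each term of a minimal
vanishing sum by a factor that it fixes, then all these factors are equal
(`eigenvalue_eq_of_minimal_sum`). Enough automorphisms are available because the image of the
cyclotomic character of `K` has index dividing `d = [K_ab : ℚ]`: for `x` prime to `N`, some
automorphism over `K` raises `N`-th roots of unity to the power `x ^ d` (`exists_algEquiv_pow`).

Denominator. Let `N` be a multiple of the denominator of `a` and of the orders of the `ξ_i`. An
automorphism fixing `K(ζ_N)` multiplies each term by a root of unity that it fixes, so the principle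
puts `λ_i ^ a / λ_j ^ a` in `K(ζ_N)`. Hence `λ_i / λ_j` is a `den(a)`-th power there, and the
Chevalley–Bass property brings this down to `K`: up to a root of unity, `λ_i / λ_j` is a `den(a) /
gcd(den(a), Λ)`-th power. As Kummer sets are closed under lcm, this number divides every Kummer
exponent, hence `ρ`. The bound `Λ ≤ (d + 1)! ^ 2 * d` comes from Kummer descent in `K(ζ_N)/K`, one
prime at a time, using an automorphism `σ` whose cyclotomic exponent is close to `1` in a controlled
way.

Orders. After division by one term, the sum becomes `∑ c_i ζ_i = 0` with one `ζ_i` equal to `1`, and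
for a bounded `m` there are endomorphisms fixing the `c_i` and raising roots of unity to any
prescribed `m`-th power exponent. Let `Q` be the lcm of the orders of the `ζ_i`. The principle
bounds the exponent of each prime in `Q`. A large prime dividing `Q` exactly once would give a
nonzero polynomial of degree below `p / (2m)` with at least `(p - 1) / m` roots.

Finiteness of `d` and of the Kummer exponents follows from finite generation, through transcendence
bases, norms and Northcott's theorem. -/

theorem sum_eval_mul_eq_zero_of_eigen {ι L : Type*} [Field L] (t : Finset ι) (σ : L →+* L)
    (z χ : ι → L) (hz : ∀ i, σ (z i) = χ i * z i) (hχ : ∀ i, σ (χ i) = χ i)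
    (h : ∑ i ∈ t, z i = 0) (g : L[X]) : ∑ i ∈ t, g.eval (χ i) * z i = 0 := by
  have hpow : ∀ j : ℕ, ∑ i ∈ t, χ i ^ j * z i = 0 := by
    intro j
    induction j with
    | zero => simpa using h
    | succ j ih =>
      -- Applying `σ` to the relation with weights `χ i ^ j` raises every exponent by one, since `σ`
      -- fixes the `χ i`.
      have := congrArg σ ih
      rw [map_sum, map_zero] at this
      rw [← this]
      refine Finset.sum_congr rfl fun i _ => ?_
      rw [map_mul, map_pow, hχ, hz]
      ring
  simp_rw [eval_eq_sum_range, Finset.sum_mul]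
  rw [Finset.sum_comm]
  refine Finset.sum_eq_zero fun j _ => ?_
  simp_rw [mul_assoc]
  rw [← Finset.mul_sum, hpow, mul_zero]

/-- In a minimal vanishing sum of eigenvectors, all the eigenvalues agree. -/
theorem eigenvalue_eq_of_minimal_sum {ι L : Type*} [Fintype ι] [Field L] (σ : L →+* L)
    (z χ : ι → L) (hz : ∀ i, σ (z i) = χ i * z i) (hχ : ∀ i, σ (χ i) = χ i)
    (h : ∑ i, z i = 0)
    (hmin : ∀ I : Finset ι, I.Nonempty → I ≠ Finset.univ → ∑ i ∈ I, z i ≠ 0) (i j : ι) :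
    χ i = χ j := by
  classical
  by_contra hij
  set c := χ j
  -- `g` kills every eigenvalue except `c`, so it isolates the part of the sum with eigenvalue `c`:
  -- a vanishing sub-sum containing `j` but not `i`.
  let g : L[X] := ∏ y ∈ (Finset.univ.image χ).erase c, (X - C y)
  have hg : ∀ k, g.eval (χ k) * z k = if χ k = c then g.eval c * z k else 0 := by
    intro k
    split_ifs with hk
    · rw [hk]
    · have : g.eval (χ k) = 0 := by
        rw [eval_prod]
        exact Finset.prod_eq_zero (i := χ k) (by simp [hk]) (by simp)
      rw [this, zero_mul]
  have hgc : g.eval c ≠ 0 := by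
    rw [eval_prod, Finset.prod_ne_zero_iff]
    intro y hy
    have := (Finset.mem_erase.1 hy).1
    simpa [sub_eq_zero] using this.symm
  have h0 := sum_eval_mul_eq_zero_of_eigen Finset.univ σ z χ hz hχ h g
  simp_rw [hg] at h0
  rw [← Finset.sum_filter, ← Finset.mul_sum] at h0
  refine hmin _ ⟨j, by simp [c]⟩ ?_ ((mul_eq_zero.1 h0).resolve_left hgc)
  intro hI
  have := Finset.mem_univ i
  rw [← hI] at this
  exact hij (Finset.mem_filter.1 this).2

/-! ### The image of the cyclotomic character -/

theorem finrank_dvd_maxAbelianDegree {k K E : Type*} [Field k] [Field K] [Algebra k K] [Field E]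
    [Algebra k E] [IsAbelianGalois k E] (ψ : E →ₐ[k] K) :
    Module.finrank k E ∣ maxAbelianDegree k K := by
  have hE : IsAbelianGalois k ψ.fieldRange :=
    IsAbelianGalois.of_algHom (AlgEquiv.ofInjectiveField ψ).symm.toAlgHom
  have hle := (isGreatest_maxAbelianSubextension k K).2 hE
  have h := IntermediateField.finrank_dvd_of_le_right hle
  let e : E ≃ₐ[k] ψ.fieldRange := AlgEquiv.ofInjectiveField ψ
  rwa [← e.toLinearEquiv.finrank_eq] at h

/-- By Galois theory in the cyclotomic field `F`, the index of the image `H` is the degree of the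
fixed field `E` of `H`. Inside `M`, `E` is fixed by every automorphism over `K`, so it embeds in `K`
as an abelian extension of `k`. -/
theorem index_range_autToPow_dvd_of_isCyclotomicExtension {k K M : Type*} [Field k] [Field K] [Field M] [Algebra k K]
    [Algebra k M] [Algebra K M] [IsScalarTower k K M] [IsGalois K M] {N : ℕ} [NeZero N] [NeZero (N : k)] {ζ : M} (hζ : IsPrimitiveRoot ζ N)
    (hirr : Irreducible (cyclotomic N k)) (F : Type*) [Field F] [Algebra k F]
    [IsCyclotomicExtension {N} k F] :
    (hζ.autToPow K).range.index ∣ maxAbelianDegree k K := by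
  have hN : 0 < N := NeZero.pos N
  have hζF := IsCyclotomicExtension.zeta_spec N k F
  have hFgal : IsGalois k F := IsCyclotomicExtension.isGalois {N} k F
  have hFfin : FiniteDimensional k F := IsCyclotomicExtension.finiteDimensional {N} k F
  let e := IsCyclotomicExtension.autEquivPow F hirr
  have hFab : IsAbelianGalois k F :=
    { is_comm := ⟨fun σ τ => e.injective (by rw [map_mul, map_mul, mul_comm])⟩ }
  have hroot : aeval ζ (minpoly k (hζF.powerBasis k).gen) = 0 := by
    rw [IsPrimitiveRoot.powerBasis_gen, ← hζF.minpoly_eq_cyclotomic_of_irreducible hirr, aeval_def,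
      ← eval_map, map_cyclotomic]
    exact hζ.isRoot_cyclotomic hN
  obtain ⟨φ, hφ⟩ : ∃ φ : F →ₐ[k] M, φ (IsCyclotomicExtension.zeta N k F) = ζ :=
    ⟨(hζF.powerBasis k).lift ζ hroot, (congrArg _ (hζF.powerBasis_gen k).symm).trans
      ((hζF.powerBasis k).lift_gen ζ hroot)⟩
  let H := (hζ.autToPow K).range
  let E := IntermediateField.fixedField (H.comap e.toMonoidHom)
  have hmem : ∀ y : E, φ (y : F) ∈ (IsScalarTower.toAlgHom k K M).range := by
    intro y
    have h1 : φ (y : F) ∈ (⊥ : IntermediateField K M) := by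
      rw [InfiniteGalois.mem_bot_iff_fixed]
      intro τ
      let h := e.symm (hζ.autToPow K τ)
      have hh : h ∈ H.comap e.toMonoidHom := by
        change e h ∈ H
        rw [MulEquiv.apply_symm_apply]
        exact ⟨τ, rfl⟩
      have hcomp : ((τ : M →ₐ[K] M).restrictScalars k).comp φ = φ.comp (h : F →ₐ[k] F) := by
        apply (hζF.powerBasis k).algHom_ext
        rw [IsPrimitiveRoot.powerBasis_gen]
        change τ (φ _) = φ (h _)
        have h2 : (hζF.autToPow k h) = hζ.autToPow K τ := e.apply_symm_apply _
        rw [hφ, ← hζ.autToPow_spec K τ, ← hζF.autToPow_spec k h, map_pow, hφ, h2]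
      have h3 := DFunLike.congr_fun hcomp (y : F)
      change τ (φ (y : F)) = φ (h (y : F)) at h3
      rw [h3]
      exact congrArg φ (y.2 ⟨h, hh⟩)
    obtain ⟨k, hk⟩ := IntermediateField.mem_bot.1 h1
    exact ⟨k, hk⟩
  let ψ : E →ₐ[k] K := (AlgEquiv.ofInjectiveField (IsScalarTower.toAlgHom k K M)).symm.toAlgHom.comp
    ((φ.comp E.val).codRestrict _ hmem)
  have hfin := finrank_dvd_maxAbelianDegree ψ
  rw [IntermediateField.finrank_eq_fixingSubgroup_index, IntermediateField.fixingSubgroup_fixedField,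
    Subgroup.index_comap_of_surjective (f := e.toMonoidHom) H e.surjective] at hfin
  exact hfin

theorem index_range_autToPow_dvd {K M : Type*} [Field K] [CharZero K] [Field M] [Algebra K M]
    [IsGalois K M] {N : ℕ} [NeZero N] {ζ : M} (hζ : IsPrimitiveRoot ζ N) :
    (hζ.autToPow K).range.index ∣ maxAbelianDegree ℚ K := by
  have : CharZero M := charZero_of_injective_algebraMap (algebraMap K M).injective
  have h0 : NeZero (N : ℚ) := NeZero.charZero
  exact @index_range_autToPow_dvd_of_isCyclotomicExtension ℚ K M _ _ _ _ _ _ _ _ N _ h0 ζ hζ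
    (cyclotomic.irreducible_rat (NeZero.pos N)) (CyclotomicField N ℚ) _ _
    (@CyclotomicField.isCyclotomicExtension N _ ℚ _ h0)

theorem exists_algEquiv_pow {K M : Type*} [Field K] [CharZero K] [Field M] [Algebra K M]
    [IsGalois K M] {N : ℕ} [NeZero N] {ζ : M} (hζ : IsPrimitiveRoot ζ N) {x : ℕ}
    (hx : x.Coprime N) : ∃ σ : M ≃ₐ[K] M, ∀ η : M, η ^ N = 1 →
      σ η = η ^ (x ^ maxAbelianDegree ℚ K) := by
  obtain ⟨c, hc⟩ := index_range_autToPow_dvd (K := K) hζ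
  let y := ZMod.unitOfCoprime x hx
  -- The quotient of the commutative group `(ZMod N)ˣ` by the image has order dividing the maximal
  -- abelian degree.
  have hy : y ^ maxAbelianDegree ℚ K ∈ (hζ.autToPow K).range := by
    rw [hc, pow_mul]
    exact Subgroup.pow_mem _ (Subgroup.pow_index_mem _ _) _
  obtain ⟨σ, hσ⟩ := hy
  refine ⟨σ, fun η hη => ?_⟩
  obtain ⟨i, -, rfl⟩ := hζ.eq_pow_of_pow_eq_one hη
  rw [map_pow, ← hζ.autToPow_spec K σ, hσ, ← pow_mul, ← pow_mul, mul_comm i, pow_mul, pow_mul]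
  congr 1
  refine pow_eq_pow_of_modEq ?_ hζ.pow_eq_one
  rw [← ZMod.natCast_eq_natCast_iff]
  simp [y]

/-! ### Algebraic elements of a finitely generated field -/

open scoped IntermediateField.algebraAdjoinAdjoin in
/-- Elements algebraic over `F` that are linearly independent over `F` stay so over a purely
transcendental extension of `F`. -/
theorem AlgebraicIndependent.linearIndependent_coe_algebraicClosure {F K ι κ : Type*} [Field F]
    [Field K] [Algebra F K] {x : ι → K} (hx : AlgebraicIndependent F x)
    {b : κ → algebraicClosure F K} (hb : LinearIndependent F b) :
    LinearIndependent (IntermediateField.adjoin F (Set.range x)) fun j => (b j : K) := by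
  rw [← LinearIndependent.iff_fractionRing (Algebra.adjoin F (Set.range x))
    (IntermediateField.adjoin F (Set.range x))]
  rw [linearIndependent_iff']
  intro s g hg
  have hP : ∀ j, ∃ P : MvPolynomial ι F, MvPolynomial.aeval x P = (g j : K) := by
    intro j
    have := (Algebra.adjoin_range_eq_range_aeval F x).le (g j).2
    exact this
  choose P hP using hP
  let A := algebraicClosure F K
  have hx' : AlgebraicIndependent A x := hx.algebraicClosure
  -- The relation, denominators cleared, is a polynomial over `A` vanishing at `x`. As `x` stays
  -- algebraically independent over `A`, each coefficient vanishes, and each is an `F`-linear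
  -- relation between the `b j`.
  let Q : MvPolynomial ι A := ∑ j ∈ s, MvPolynomial.C (b j) * (P j).map (algebraMap F A)
  have hQ : MvPolynomial.aeval x Q = 0 := by
    simp only [Q, map_sum, map_mul, MvPolynomial.aeval_C, MvPolynomial.aeval_map_algebraMap, hP]
    rw [← hg]
    refine Finset.sum_congr rfl fun j _ => ?_
    rw [mul_comm]
    rfl
  have hQ0 : Q = 0 := (injective_iff_map_eq_zero _).1 hx' Q hQ
  have hcoeff : ∀ m, ∀ j ∈ s, (P j).coeff m = 0 := by
    intro m
    refine linearIndependent_iff'.1 hb s (fun j => (P j).coeff m) ?_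
    have := congrArg (MvPolynomial.coeff m) hQ0
    simp only [Q, MvPolynomial.coeff_sum, MvPolynomial.coeff_C_mul, MvPolynomial.coeff_map,
      MvPolynomial.coeff_zero] at this
    rw [← this]
    refine Finset.sum_congr rfl fun j _ => ?_
    rw [Algebra.smul_def, mul_comm]
  intro j hj
  have : P j = 0 := MvPolynomial.ext _ _ fun m => by simpa using hcoeff m j hj
  have h0 := hP j
  rw [this, map_zero] at h0
  exact Subtype.ext h0.symm

theorem finiteDimensional_of_fg_of_isAlgebraic {F K : Type*} [Field F] [Field K] [Algebra F K]
    (hfg : (⊤ : IntermediateField F K).FG) (E : IntermediateField F K) [Algebra.IsAlgebraic E K] :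
    FiniteDimensional E K := by
  obtain ⟨S, hS⟩ := hfg
  have hST : IntermediateField.adjoin E (S : Set K) = ⊤ := by
    rw [← IntermediateField.restrictScalars_eq_top_iff (K := F), eq_top_iff, ← hS,
      IntermediateField.adjoin_le_iff]
    exact IntermediateField.subset_adjoin E (S : Set K)
  have := IntermediateField.finiteDimensional_adjoin (K := E) (L := K) (S := (S : Set K))
    fun x _ => (Algebra.IsAlgebraic.isAlgebraic x).isIntegral
  rw [hST] at this
  exact IntermediateField.topEquiv.toLinearEquiv.finiteDimensional

/-- `K` is finite over the field generated by a transcendence basis, and an `F`-basis of the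
algebraic closure stays independent over that field. -/
theorem finiteDimensional_algebraicClosure_of_fg {F K : Type*} [Field F] [Field K] [Algebra F K]
    (hfg : (⊤ : IntermediateField F K).FG) : FiniteDimensional F (algebraicClosure F K) := by
  obtain ⟨s, hs⟩ := exists_isTranscendenceBasis F K
  have hfin : FiniteDimensional (IntermediateField.adjoin F (Set.range ((↑) : s → K))) K := by
    have := hs.isAlgebraic_field
    exact finiteDimensional_of_fg_of_isAlgebraic hfg _
  let b := Module.Basis.ofVectorSpace F (algebraicClosure F K)
  have hb := hs.1.linearIndependent_coe_algebraicClosure b.linearIndependent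
  have := hb.finite
  exact Module.Finite.of_basis b

theorem maxAbelianDegree_pos_of_fg {F K : Type*} [Field F] [Field K] [Algebra F K]
    (hfg : (⊤ : IntermediateField F K).FG) : 0 < maxAbelianDegree F K := by
  have h1 := finiteDimensional_algebraicClosure_of_fg hfg
  have hab : IsAbelianGalois F (maxAbelianSubextension F K) :=
    (isGreatest_maxAbelianSubextension F K).1
  have hle : maxAbelianSubextension F K ≤ algebraicClosure F K :=
    le_algebraicClosure F K _
  have : FiniteDimensional F (maxAbelianSubextension F K) :=
    FiniteDimensional.of_injective (IntermediateField.inclusion hle).toLinearMap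
      (IntermediateField.inclusion hle).injective
  exact Module.finrank_pos

/-! ### Kummer exponents -/

theorem RatFunc.intDegree_pow {F : Type*} [Field F] {x : RatFunc F} (hx : x ≠ 0) (n : ℕ) :
    RatFunc.intDegree (x ^ n) = n * RatFunc.intDegree x := by
  induction n with
  | zero => simp
  | succ n ih =>
    rw [pow_succ, RatFunc.intDegree_mul (pow_ne_zero n hx) hx, ih]
    push_cast
    ring

theorem RatFunc.intDegree_eq_zero_of_isOfFinOrder {F : Type*} [Field F] {x : RatFunc F}
    (hx : IsOfFinOrder x) : RatFunc.intDegree x = 0 := by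
  obtain ⟨n, hn, h⟩ := isOfFinOrder_iff_pow_eq_one.1 hx
  have hx0 : x ≠ 0 := by
    rintro rfl
    rw [zero_pow hn.ne'] at h
    exact zero_ne_one h
  have := RatFunc.intDegree_pow hx0 n
  rw [h, RatFunc.intDegree_one] at this
  simpa [hn.ne'] using this.symm

/-- The degree of the norm to `F(α)`, a rational function field in `α`, is a homomorphism from
nonzero elements to `ℤ`. It kills roots of unity and sends `α` to `[K : F(α)]`, so every `n` in the
Kummer set divides `[K : F(α)]`. -/
theorem bddAbove_kummerSet_of_finiteDimensional_adjoin {F K : Type*} [Field F] [Field K]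
    [Algebra F K] {α : K} (hα : Transcendental F α)
    [FiniteDimensional (IntermediateField.adjoin F {α}) K] : BddAbove (kummerSet α) := by
  let E := IntermediateField.adjoin F {α}
  let e : RatFunc F ≃ₐ[F] E := RatFunc.algEquivOfTranscendental α hα
  let D : K →* RatFunc F := (e.symm : E →* RatFunc F).comp (Algebra.norm E)
  have hD : ∀ x, x ≠ 0 → D x ≠ 0 := by
    intro x hx
    have h1 : IsUnit (D x) := (Ne.isUnit hx).map D
    exact h1.ne_zero
  have hα0 : α ≠ 0 := fun h => hα (h ▸ isAlgebraic_zero)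
  have hDα : D α = RatFunc.X ^ Module.finrank E K := by
    have h1 : α = algebraMap E K (IntermediateField.AdjoinSimple.gen F α) := rfl
    change e.symm (Algebra.norm E α) = _
    conv_lhs => rw [h1, Algebra.norm_algebraMap, map_pow]
    rw [RatFunc.algEquivOfTranscendental_symm_gen]
  refine ⟨Module.finrank E K, ?_⟩
  rintro n ⟨hn, ξ, β, hξ, h⟩
  have hξ0 : ξ ≠ 0 := hξ.isUnit.ne_zero
  have hβ0 : β ≠ 0 := by
    rintro rfl
    rw [zero_pow hn.ne'] at h
    exact mul_ne_zero hα0 hξ0 h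
  have h2 := congrArg RatFunc.intDegree (congrArg D h)
  rw [map_mul, map_pow, RatFunc.intDegree_mul (hD α hα0) (hD ξ hξ0), hDα,
    RatFunc.intDegree_pow RatFunc.X_ne_zero, RatFunc.intDegree_pow (hD β hβ0), RatFunc.intDegree_X,
    RatFunc.intDegree_eq_zero_of_isOfFinOrder (D.isOfFinOrder hξ)] at h2
  have hpos : 0 < Module.finrank E K := Module.finrank_pos
  have hdvd : (n : ℤ) ∣ (Module.finrank E K : ℤ) := ⟨_, by simpa using h2⟩
  exact Nat.le_of_dvd hpos (Int.natCast_dvd_natCast.1 hdvd)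

theorem bddAbove_kummerSet_of_transcendental {F K : Type*} [Field F] [Field K] [Algebra F K]
    (hfg : (⊤ : IntermediateField F K).FG) {α : K} (hα : Transcendental F α) :
    BddAbove (kummerSet α) := by
  obtain ⟨s, hαs, hs⟩ := exists_isTranscendenceBasis_superset (R := F) (s := {α})
    ((algebraicIndependent_singleton_iff (⟨α, rfl⟩ : ({α} : Set K))).2 hα)
  rw [Set.singleton_subset_iff] at hαs
  -- The rest of a transcendence basis through `α` is absorbed into the base field, so that `K`
  -- becomes finite over `F'(α)`.
  let F' := IntermediateField.adjoin F (s \ {α})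
  have hunion : s \ {α} ∪ {α} = s := by
    rw [Set.sdiff_union_self, Set.union_eq_left, Set.singleton_subset_iff]
    exact hαs
  have htr : Transcendental F' α := by
    rw [IntermediateField.transcendental_adjoin_iff]
    have h := hs.1.transcendental_adjoin (s := {j : s | (j : K) ≠ α}) (i := ⟨α, hαs⟩) (by simp)
    have himg : ((↑) : s → K) '' {j : s | (j : K) ≠ α} = s \ {α} := by
      ext y
      simp [and_comm]
    rwa [himg] at h
  have hfg' : (⊤ : IntermediateField F' K).FG := by
    obtain ⟨S, hS⟩ := hfg
    refine ⟨S, ?_⟩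
    rw [← IntermediateField.restrictScalars_eq_top_iff (K := F), eq_top_iff, ← hS,
      IntermediateField.adjoin_le_iff]
    exact IntermediateField.subset_adjoin F' (S : Set K)
  have halg : Algebra.IsAlgebraic (IntermediateField.adjoin F' {α}) K := by
    have h1 := hs.isAlgebraic_field
    rw [Subtype.range_coe] at h1
    have h2 : (IntermediateField.adjoin F' {α}).restrictScalars F = IntermediateField.adjoin F s := by
      rw [IntermediateField.adjoin_adjoin_left, hunion]
    rw [← h2] at h1
    exact h1
  have := finiteDimensional_of_fg_of_isAlgebraic hfg' (IntermediateField.adjoin F' {α})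
  exact bddAbove_kummerSet_of_finiteDimensional_adjoin htr

theorem le_max_one_of_pow_eq {a b : ℝ} {n : ℕ} (hn : 0 < n) (h : a ^ n = b) : a ≤ max 1 b := by
  rcases le_total a 1 with h1 | h1
  · exact h1.trans (le_max_left _ _)
  · exact le_trans (le_self_pow₀ h1 hn.ne') (h.le.trans (le_max_right _ _))

theorem IsOfFinOrder.inv₀ {K : Type*} [Field K] {x : K} (hx : IsOfFinOrder x) :
    IsOfFinOrder x⁻¹ := by
  obtain ⟨n, hn, h⟩ := isOfFinOrder_iff_pow_eq_one.1 hx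
  exact isOfFinOrder_iff_pow_eq_one.2 ⟨n, hn, by rw [inv_pow, h, inv_one]⟩

theorem IsOfFinOrder.zpow₀ {K : Type*} [Field K] {x : K} (hx : IsOfFinOrder x) (k : ℤ) :
    IsOfFinOrder (x ^ k) := by
  cases k with
  | ofNat k => simpa using hx.pow
  | negSucc k => simpa using (hx.pow (n := k + 1)).inv₀

theorem isOfFinOrder_of_mul_eq_pow_of_mul_eq_pow {K : Type*} [Field K] {α β ξ ξ' : K} {n n' : ℕ}
    (h0 : α ≠ 0) (hξ : IsOfFinOrder ξ) (hξ' : IsOfFinOrder ξ') (h : α * ξ = β ^ n)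
    (h' : α * ξ' = β ^ n') (hlt : n < n') : IsOfFinOrder α := by
  have hξ0 := hξ.isUnit.ne_zero
  have hβ0 : β ^ n ≠ 0 := h ▸ mul_ne_zero h0 hξ0
  have h1 : β ^ (n' - n) = ξ' * ξ⁻¹ := by
    apply mul_left_cancel₀ hβ0
    rw [← pow_add, Nat.add_sub_cancel' hlt.le, ← h', ← h]
    field_simp
  have h2 : IsOfFinOrder (β ^ (n' - n)) := h1 ▸ hξ'.mul hξ.inv₀
  have h3 : IsOfFinOrder β := (isOfFinOrder_pow.1 h2).resolve_right (by omega)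
  have h4 : α = β ^ n * ξ⁻¹ := by
    rw [← h]
    field_simp
  rw [h4]
  exact h3.pow.mul hξ.inv₀

/-- The radicals `β n` have a common denominator `m` and bounded absolute values, so by Northcott an
infinite Kummer set would give `β n = β n'` with `n ≠ n'`. Then a positive power of `β n`, and hence
`α`, would be a root of unity. -/
theorem bddAbove_kummerSet_of_numberField {K : Type*} [Field K] [NumberField K] {α : K}
    (h0 : α ≠ 0) (htor : ¬ IsOfFinOrder α) : BddAbove (kummerSet α) := by
  by_contra hbdd
  have hinf : (kummerSet α).Infinite := fun h => hbdd h.bddAbove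
  obtain ⟨m, hm0, hm⟩ := IsAlgebraic.exists_integral_multiple
    ((IsFractionRing.isAlgebraic_iff ℤ ℚ K).2 (Algebra.IsAlgebraic.isAlgebraic α))
  have hex : ∀ n : ℕ, ∃ β : K, n ∈ kummerSet α → ∃ ξ, IsOfFinOrder ξ ∧ α * ξ = β ^ n := by
    intro n
    by_cases hn : n ∈ kummerSet α
    · obtain ⟨-, ξ, β, h⟩ := hn
      exact ⟨β, fun _ => ⟨ξ, h⟩⟩
    · exact ⟨0, fun h => absurd h hn⟩
  choose β hβ using hex
  let B : ℝ := |(m : ℝ)| * (1 + ∑ φ : K →+* ℂ, ‖φ α‖)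
  have hmaps : Set.MapsTo (fun n => (m : K) * β n) (kummerSet α)
      {x : K | IsIntegral ℤ x ∧ ∀ φ : K →+* ℂ, ‖φ x‖ ≤ B} := by
    intro n hn
    obtain ⟨ξ, hξ, h⟩ := hβ n hn
    have hn0 : 0 < n := hn.1
    refine ⟨?_, fun φ => ?_⟩
    · refine IsIntegral.of_pow hn0 ?_
      have hξi : IsIntegral ℤ ξ := by
        obtain ⟨r, hr, h1⟩ := isOfFinOrder_iff_pow_eq_one.1 hξ
        exact IsIntegral.of_pow hr (h1 ▸ isIntegral_one)
      have h1 : ((m : K) * β n) ^ n = (m : K) ^ (n - 1) * (m • α) * ξ := by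
        obtain ⟨k, rfl⟩ : ∃ k, n = k + 1 := ⟨n - 1, by omega⟩
        rw [mul_pow, ← h, zsmul_eq_mul, Nat.add_sub_cancel]
        ring
      rw [h1]
      exact (((isIntegral_algebraMap (x := m)).pow _).mul hm).mul hξi
    · rw [map_mul, norm_mul, map_intCast, Complex.norm_intCast]
      refine mul_le_mul_of_nonneg_left ?_ (abs_nonneg _)
      have hφξ : ‖φ ξ‖ = 1 := (φ.toMonoidHom.isOfFinOrder hξ).norm_eq_one
      have h1 : ‖φ (β n)‖ ^ n = ‖φ α‖ := by
        rw [← norm_pow, ← map_pow, ← h, map_mul, norm_mul, hφξ, mul_one]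
      have h2 := Finset.single_le_sum (f := fun φ : K →+* ℂ => ‖φ α‖) (fun _ _ => norm_nonneg _)
        (Finset.mem_univ φ)
      refine (le_max_one_of_pow_eq hn0 h1).trans (max_le ?_ ?_)
      · linarith [norm_nonneg (φ α)]
      · linarith
  obtain ⟨n, hn, n', hn', hne, heq⟩ := hinf.exists_ne_map_eq_of_mapsTo hmaps
    (NumberField.Embeddings.finite_of_norm_le K ℂ B)
  have hββ : β n = β n' := mul_left_cancel₀ (Int.cast_ne_zero.2 hm0) heq
  obtain ⟨ξ, hξ, h⟩ := hβ n hn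
  obtain ⟨ξ', hξ', h'⟩ := hβ n' hn'
  rw [hββ] at h
  rcases lt_or_gt_of_ne hne with hlt | hlt
  · exact htor (isOfFinOrder_of_mul_eq_pow_of_mul_eq_pow h0 hξ hξ' h h' hlt)
  · exact htor (isOfFinOrder_of_mul_eq_pow_of_mul_eq_pow h0 hξ' hξ h' h hlt)

theorem bddAbove_kummerSet_of_fg {K : Type*} [Field K] [CharZero K]
    (hfg : (⊤ : IntermediateField ℚ K).FG) {α : K} (h0 : α ≠ 0) (htor : ¬ IsOfFinOrder α) :
    BddAbove (kummerSet α) := by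
  by_cases hα : Transcendental ℚ α
  · exact bddAbove_kummerSet_of_transcendental hfg hα
  let A := algebraicClosure ℚ K
  have hfin : FiniteDimensional ℚ A := finiteDimensional_algebraicClosure_of_fg hfg
  have hA : NumberField A := { to_finiteDimensional := by convert hfin }
  have hmem : ∀ {x : K}, x ∈ A ↔ IsAlgebraic ℚ x := mem_algebraicClosure_iff
  let α' : A := ⟨α, hmem.2 (not_not.1 hα)⟩
  have hinj : Function.Injective (algebraMap A K) := (algebraMap A K).injective
  have hord : ∀ x : A, IsOfFinOrder x ↔ IsOfFinOrder (x : K) := fun x =>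
    (hinj.isOfFinOrder_iff (f := (algebraMap A K : A →* K))).symm
  refine (bddAbove_kummerSet_of_numberField (α := α') (fun h => h0 (congrArg Subtype.val h))
    (fun h => htor ((hord α').1 h))).mono ?_
  rintro n ⟨hn, ξ, β, hξ, h⟩
  have hξA : IsAlgebraic ℚ ξ := by
    obtain ⟨r, hr, h1⟩ := isOfFinOrder_iff_pow_eq_one.1 hξ
    exact IsAlgebraic.of_pow hr (h1 ▸ isAlgebraic_one)
  have hβA : IsAlgebraic ℚ β := IsAlgebraic.of_pow hn (h ▸ (not_not.1 hα).mul hξA)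
  exact ⟨hn, ⟨ξ, hmem.2 hξA⟩, ⟨β, hmem.2 hβA⟩, (hord _).2 hξ, Subtype.ext h⟩

/-! ### Divisibility properties of the Kummer exponent -/

/-- If `α ^ k` and `γ ^ n` agree up to a root of unity, then `α` is, up to a root of unity, an
`n / gcd n k`-th power. -/
theorem div_gcd_mem_kummerSet {K : Type*} [Field K] {α γ ζ : K} {k n : ℕ} (hn : 0 < n)
    (h0 : α ≠ 0) (hζ : IsOfFinOrder ζ) (h : α ^ k = γ ^ n * ζ) : n / n.gcd k ∈ kummerSet α := by
  set g := n.gcd k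
  have hg : 0 < g := Nat.gcd_pos_of_pos_left _ hn
  obtain ⟨a, ha⟩ := Nat.gcd_dvd_left n k
  obtain ⟨b, hb⟩ := Nat.gcd_dvd_right n k
  have hna : n / g = a := Nat.div_eq_of_eq_mul_right hg ha
  have ha0 : 0 < a := Nat.pos_of_mul_pos_left (ha ▸ hn)
  have hcop : a.Coprime b := by
    have := Nat.coprime_div_gcd_div_gcd (m := n) (n := k) hg
    rwa [Nat.div_eq_of_eq_mul_right hg ha, Nat.div_eq_of_eq_mul_right hg hb] at this
  have hζ0 := hζ.isUnit.ne_zero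
  have hγ0 : γ ≠ 0 := by
    rintro rfl
    rw [zero_pow hn.ne', zero_mul] at h
    exact pow_ne_zero _ h0 h
  rw [hna]
  -- `η ^ g = ζ`, so `α ^ b` equals `γ ^ a` up to the root of unity `η`. Bézout for the coprime pair
  -- `a`, `b` then exhibits `α` as an `a`-th power up to a power of `η`.
  let η := α ^ b * (γ ^ a)⁻¹
  have hη : IsOfFinOrder η := by
    have h1 : IsOfFinOrder (η ^ g) := by
      rw [mul_pow, inv_pow, ← pow_mul, ← pow_mul, mul_comm b, mul_comm a, ← ha, ← hb, h,
        mul_comm, inv_mul_cancel_left₀ (pow_ne_zero _ hγ0)]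
      exact hζ
    exact (isOfFinOrder_pow.1 h1).resolve_right hg.ne'
  have hbez : (a : ℤ) * a.gcdA b + b * a.gcdB b = 1 := by
    rw [← Nat.gcd_eq_gcd_ab, hcop.gcd_eq_one, Nat.cast_one]
  have hαb : α ^ b = γ ^ a * η := by
    simp only [η]
    field_simp
  refine ⟨ha0, η ^ (-(a.gcdB b)), α ^ a.gcdA b * γ ^ a.gcdB b, hη.zpow₀ _, ?_⟩
  have hη0 := hη.isUnit.ne_zero
  have h1 : α = (α ^ a) ^ a.gcdA b * (α ^ b) ^ a.gcdB b := by
    rw [← zpow_natCast, ← zpow_natCast, ← zpow_mul, ← zpow_mul, ← zpow_add₀ h0, hbez, zpow_one]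
  conv_lhs => rw [h1, hαb, mul_zpow, mul_assoc, mul_assoc, ← zpow_add₀ hη0, add_neg_cancel,
    zpow_zero, mul_one]
  rw [mul_pow, ← zpow_natCast, ← zpow_natCast, ← zpow_natCast, ← zpow_natCast, ← zpow_mul,
    ← zpow_mul, ← zpow_mul, ← zpow_mul, mul_comm (a : ℤ), mul_comm (a : ℤ)]

theorem one_mem_kummerSet {K : Type*} [Field K] (α : K) : 1 ∈ kummerSet α :=
  ⟨one_pos, 1, α, IsOfFinOrder.one, by simp⟩

/-- This closure property turns the largest element of the Kummer set into a common multiple of all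
its elements. -/
theorem lcm_mem_kummerSet {K : Type*} [Field K] {α : K} {n m : ℕ} (h0 : α ≠ 0)
    (hn : n ∈ kummerSet α) (hm : m ∈ kummerSet α) : n.lcm m ∈ kummerSet α := by
  obtain ⟨hn0, ξ, β, hξ, h⟩ := hn
  obtain ⟨hm0, ξ', β', hξ', h'⟩ := hm
  obtain ⟨a, b, hcop, ha, hb⟩ := Nat.exists_coprime n m
  have hlcm : n.lcm m = a * b * n.gcd m := by
    have h1 : (a * n.gcd m).lcm (b * n.gcd m) = a * b * n.gcd m := by
      rw [Nat.lcm_mul_right, hcop.lcm_eq_mul]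
    rwa [← ha, ← hb] at h1
  have hL1 : n.lcm m = n * b := by
    conv_rhs => rw [ha]
    rw [hlcm, mul_right_comm]
  have hL2 : n.lcm m = m * a := by
    conv_rhs => rw [hb]
    rw [hlcm, mul_assoc, mul_comm]
  have key := div_gcd_mem_kummerSet (α := α) (γ := β ^ (a.gcdB b) * β' ^ (a.gcdA b)) (k := 1)
    (n := n.lcm m) (ζ := (ξ ^ (b * a.gcdB b) * ξ' ^ (a * a.gcdA b))⁻¹)
    (Nat.lcm_pos hn0 hm0) h0
    ((hξ.zpow₀ _).mul (hξ'.zpow₀ _)).inv₀ ?_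
  · simpa using key
  have hξ0 := hξ.isUnit.ne_zero
  have hξ0' := hξ'.isUnit.ne_zero
  have hbez : (b * a.gcdB b : ℤ) + a * a.gcdA b = 1 := by
    rw [add_comm, ← Nat.gcd_eq_gcd_ab, hcop.gcd_eq_one, Nat.cast_one]
  have e1 : (β ^ (a.gcdB b)) ^ n.lcm m = (α * ξ) ^ (b * a.gcdB b) := by
    rw [h, hL1, ← zpow_natCast, ← zpow_natCast, ← zpow_mul, ← zpow_mul]
    congr 1
    push_cast
    ring
  have e2 : (β' ^ (a.gcdA b)) ^ n.lcm m = (α * ξ') ^ (a * a.gcdA b) := by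
    rw [h', hL2, ← zpow_natCast, ← zpow_natCast, ← zpow_mul, ← zpow_mul]
    congr 1
    push_cast
    ring
  rw [mul_pow, e1, e2, mul_zpow, mul_zpow, mul_mul_mul_comm, ← zpow_add₀ h0, hbez, zpow_one,
    pow_one, mul_inv_cancel_right₀]
  exact mul_ne_zero (zpow_ne_zero _ hξ0) (zpow_ne_zero _ hξ0')

theorem kummerExponent_mem {K : Type*} [Field K] {α : K} (hb : BddAbove (kummerSet α)) :
    kummerExponent α ∈ kummerSet α :=
  Nat.sSup_mem ⟨1, one_mem_kummerSet α⟩ hb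

theorem dvd_kummerExponent {K : Type*} [Field K] {α : K} (h0 : α ≠ 0)
    (hb : BddAbove (kummerSet α)) {n : ℕ} (hn : n ∈ kummerSet α) : n ∣ kummerExponent α := by
  have hmem := kummerExponent_mem hb
  have h1 := lcm_mem_kummerSet h0 hn hmem
  have h2 : n.lcm (kummerExponent α) ≤ kummerExponent α := le_csSup hb h1
  have h3 := Nat.le_of_dvd h1.1 (Nat.dvd_lcm_right n (kummerExponent α))
  rw [← le_antisymm h2 h3]
  exact Nat.dvd_lcm_left _ _

/-! ### Kummer descent along cyclotomic extensions -/

section KummerDescent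

variable {K M : Type*} [Field K] [Field M] [Algebra K M]

theorem pow_eq_one_of_gcd {G : Type*} [Field G] {c : G} {a : ℤ} {P : ℕ} (hc0 : c ≠ 0)
    (h1 : c ^ a = 1) (h2 : c ^ P = 1) : c ^ (a.gcd P) = 1 := by
  rw [← zpow_natCast, Int.gcd_eq_gcd_ab, zpow_add₀ hc0, zpow_mul, zpow_mul, h1, zpow_natCast, h2,
    one_zpow, one_zpow, one_mul]

/-- If `β` is fixed by an automorphism raising `P`-th roots of unity to the `u`-th power, and
`β ^ P ∈ K`, then `β ^ gcd (u - 1) P ∈ K`. -/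
theorem exists_algebraMap_eq_pow_gcd_of_fixed [IsGalois K M]
    (hcomm : ∀ σ τ : M ≃ₐ[K] M, σ * τ = τ * σ) {P u : ℕ} (hP : 0 < P) {α : K} (h0 : α ≠ 0)
    {β : M} (hβ : β ^ P = algebraMap K M α) {σ : M ≃ₐ[K] M}
    (hσ : ∀ η : M, η ^ P = 1 → σ η = η ^ u) (hfix : σ β = β) :
    ∃ γ : K, algebraMap K M γ = β ^ ((u : ℤ) - 1).gcd P := by
  have hβ0 : β ≠ 0 := by
    rintro rfl
    rw [zero_pow hP.ne', eq_comm, map_eq_zero] at hβ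
    exact h0 hβ
  rw [← Set.mem_range, ← IntermediateField.mem_bot, InfiniteGalois.mem_bot_iff_fixed]
  intro τ
  have hτ0 : τ β ≠ 0 := by simpa using hβ0
  -- `c` is a `P`-th root of unity, and `σ` fixes it because `σ` and `τ` commute. So `c ^ (u - 1) =
  -- 1`, and `τ` fixes `β ^ gcd (u - 1) P`.
  set c := τ β / β with hc
  have hc0 : c ≠ 0 := div_ne_zero hτ0 hβ0
  have hcP : c ^ P = 1 := by
    rw [hc, div_pow, ← map_pow, hβ, AlgEquiv.commutes, div_self]
    rwa [Ne, map_eq_zero]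
  have hσc : σ c = c := by
    have := DFunLike.congr_fun (hcomm σ τ) β
    rw [AlgEquiv.mul_apply, AlgEquiv.mul_apply, hfix] at this
    rw [hc, map_div₀, this, hfix]
  have hcu : c ^ ((u : ℤ) - 1) = 1 := by
    rw [zpow_sub₀ hc0, zpow_natCast, zpow_one, ← hσ c hcP, hσc, div_self hc0]
  have hcg := pow_eq_one_of_gcd hc0 hcu hcP
  rw [hc, div_pow, div_eq_one_iff_eq (pow_ne_zero _ hβ0)] at hcg
  rwa [map_pow]

/-- A radical can be multiplied by a root of unity to become fixed under `σ`, as soon as the value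
of its Kummer cocycle at `σ` is killed by `P / gcd (u - 1) P`. -/
theorem exists_root_of_unity_mul_fixed {P u g : ℕ} (hP : 0 < P) {ζ : M} (hζ : IsPrimitiveRoot ζ P)
    {β : M} {σ : M ≃ₐ[K] M} (hσ : ∀ η : M, η ^ P = 1 → σ η = η ^ u)
    (hg : ((u : ℤ) - 1).gcd P = g) {c : M} (hc : σ β = c * β) (hcg : c ^ (P / g) = 1) :
    ∃ κ : M, κ ^ P = 1 ∧ σ (β * κ) = β * κ := by
  have : NeZero P := ⟨hP.ne'⟩
  have hζ0 : ζ ≠ 0 := hζ.ne_zero hP.ne'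
  have hgP : g ∣ P := by
    rw [← hg]
    exact Int.natCast_dvd_natCast.1 (Int.gcd_dvd_right _ _)
  obtain ⟨r, hr⟩ := hgP
  have hg0 : 0 < g := Nat.pos_of_mul_pos_right (hr ▸ hP)
  rw [hr, Nat.mul_div_cancel_left _ hg0] at hcg
  have hr0 : 0 < r := Nat.pos_of_mul_pos_left (hr ▸ hP)
  obtain ⟨j, -, rfl⟩ := hζ.eq_pow_of_pow_eq_one (ξ := c) (by rw [hr, mul_comm, pow_mul, hcg, one_pow])
  obtain ⟨j', rfl⟩ : g ∣ j := by
    rw [← pow_mul, hζ.pow_eq_one_iff_dvd, hr] at hcg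
    exact Nat.dvd_of_mul_dvd_mul_right hr0 hcg
  have hbez : (g : ℤ) = ((u : ℤ) - 1) * ((u : ℤ) - 1).gcdA P + P * ((u : ℤ) - 1).gcdB P := by
    rw [← Int.gcd_eq_gcd_ab, hg]
  set a := ((u : ℤ) - 1).gcdA P
  set b := ((u : ℤ) - 1).gcdB P
  have hκ : (ζ ^ (-(a * j'))) ^ P = 1 := by
    rw [← zpow_natCast, ← zpow_mul, mul_comm, zpow_mul, zpow_natCast, hζ.pow_eq_one, one_zpow]
  -- The equation to solve is `κ ^ (u - 1) = c⁻¹` with `c = ζ ^ (g * j')`; Bézout for `g = gcd (u -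
  -- 1) P` gives the exponent.
  refine ⟨ζ ^ (-(a * j')), hκ, ?_⟩
  rw [map_mul, hσ _ hκ, hc]
  have h1 : ζ ^ (g * j') * (ζ ^ (-(a * j'))) ^ u = ζ ^ (-(a * j')) := by
    have h2 : (ζ ^ (P : ℤ)) = 1 := by rw [zpow_natCast, hζ.pow_eq_one]
    calc ζ ^ (g * j') * (ζ ^ (-(a * j'))) ^ u
        = ζ ^ ((P : ℤ) * (b * j') + (-(a * j'))) := by
          rw [← zpow_natCast, ← zpow_natCast, ← zpow_mul, ← zpow_add₀ hζ0]
          congr 1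
          push_cast
          rw [hbez]
          ring
      _ = ζ ^ (-(a * j')) := by rw [zpow_add₀ hζ0, zpow_mul, h2, one_zpow, one_mul]
  rw [mul_right_comm, h1, mul_comm]

theorem iterate_cocycle {P u : ℕ} {β c : M} {σ : M ≃ₐ[K] M}
    (hσ : ∀ η : M, η ^ P = 1 → σ η = η ^ u) (hc : σ β = c * β) (hcP : c ^ P = 1) (k : ℕ) :
    (σ ^ k) β = c ^ (∑ i ∈ Finset.range k, u ^ i) * β := by
  induction k with
  | zero => simp
  | succ k ih =>
    rw [pow_succ', AlgEquiv.mul_apply, ih, map_mul, map_pow, hσ c hcP, hc, Finset.sum_range_succ',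
      pow_zero, pow_succ, mul_assoc, ← pow_mul]
    congr 2
    rw [Finset.mul_sum]
    exact Finset.sum_congr rfl fun i _ => by rw [pow_succ, mul_comm]

/-- Correct `β` by a root of unity `κ` so that `σ` fixes it; then `(β * κ) ^ g` lies in `K` and is
the required root. The correction needs `c ^ (P / g) = 1`: this is clear for `g = 1`, and otherwise
iterating the cocycle up to `σ ^ k = 1` bounds the order of `c`. -/
theorem exists_pow_eq_of_cyclotomic [IsGalois K M]
    (hcomm : ∀ σ τ : M ≃ₐ[K] M, σ * τ = τ * σ) {P u g k : ℕ} (hP : 0 < P) {ζ : M}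
    (hζ : IsPrimitiveRoot ζ P) {α : K} (h0 : α ≠ 0) {β : M} (hβ : β ^ P = algebraMap K M α)
    {σ : M ≃ₐ[K] M} (hσ : ∀ η : M, η ^ P = 1 → σ η = η ^ u)
    (hg : ((u : ℤ) - 1).gcd P = g)
    (hk : g = 1 ∨ σ ^ k = 1 ∧ (∑ i ∈ Finset.range k, u ^ i).gcd P ∣ P / g) :
    ∃ γ : K, γ ^ (P / g) = α := by
  have hβ0 : β ≠ 0 := by
    rintro rfl
    rw [zero_pow hP.ne', eq_comm, map_eq_zero] at hβ
    exact h0 hβ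
  set c := σ β / β with hc
  have hcβ : σ β = c * β := by rw [hc, div_mul_cancel₀ _ hβ0]
  have hcP : c ^ P = 1 := by
    rw [hc, div_pow, ← map_pow, hβ, AlgEquiv.commutes, div_self]
    rwa [Ne, map_eq_zero]
  have hc0 : c ≠ 0 := by
    intro h
    rw [h, zero_pow hP.ne'] at hcP
    exact zero_ne_one hcP
  have hcg : c ^ (P / g) = 1 := by
    rcases hk with rfl | ⟨hk1, hk2⟩
    · rw [Nat.div_one, hcP]
    · have h1 := iterate_cocycle hσ hcβ hcP k
      rw [hk1, AlgEquiv.one_apply, eq_comm, mul_eq_right₀ hβ0] at h1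
      have h2 := pow_eq_one_of_gcd (a := ((∑ i ∈ Finset.range k, u ^ i : ℕ) : ℤ)) hc0
        (by rw [zpow_natCast, h1]) hcP
      obtain ⟨r, hr⟩ := hk2
      rw [Int.gcd_natCast_natCast] at h2
      rw [hr, pow_mul, h2, one_pow]
  obtain ⟨κ, hκ, hfix⟩ := exists_root_of_unity_mul_fixed hP hζ hσ hg hcβ hcg
  obtain ⟨γ, hγ⟩ := exists_algebraMap_eq_pow_gcd_of_fixed hcomm hP h0
    (by rw [mul_pow, hκ, mul_one, hβ]) hσ hfix
  refine ⟨γ, (algebraMap K M).injective ?_⟩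
  have hgP : g ∣ P := by
    rw [← hg]
    exact Int.natCast_dvd_natCast.1 (Int.gcd_dvd_right _ _)
  rw [map_pow, hγ, hg, ← pow_mul, Nat.mul_div_cancel' hgP, mul_pow, hκ, mul_one, hβ]

end KummerDescent

/-! ### Lifting the exponent -/

theorem emultiplicity_pow_sub_one {p : ℕ} (hp : p.Prime) {x : ℤ} (hx : (p : ℤ) ∣ x - 1)
    (hx2 : p = 2 → (4 : ℤ) ∣ x - 1) (n : ℕ) :
    emultiplicity (p : ℤ) (x ^ n - 1) = emultiplicity (p : ℤ) (x - 1) + emultiplicity p n := by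
  have hpx : ¬ (p : ℤ) ∣ x := by
    intro h
    have h1 : (p : ℤ) ∣ 1 := by simpa using dvd_sub h hx
    exact hp.one_lt.ne' (by exact_mod_cast Int.eq_one_of_dvd_one (by positivity) h1)
  rcases hp.eq_two_or_odd' with rfl | hodd
  · have := Int.two_pow_sub_pow' (x := x) (y := 1) n (hx2 rfl) (by exact_mod_cast hpx)
    rw [one_pow] at this
    rw [← Int.natCast_emultiplicity 2 n]
    exact_mod_cast this
  · have := Int.emultiplicity_pow_sub_pow hp hodd (x := x) (y := 1) hx hpx n
    rwa [one_pow] at this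

/-! ### The Chevalley–Bass property -/

theorem exists_pow_eq_mul_of_coprime {K : Type*} [Field K] {α : K} (h0 : α ≠ 0) {a b : ℕ}
    (hab : a.Coprime b) (ha : ∃ γ : K, γ ^ a = α) (hb : ∃ γ : K, γ ^ b = α) :
    ∃ γ : K, γ ^ (a * b) = α := by
  obtain ⟨γ, hγ⟩ := ha
  obtain ⟨δ, hδ⟩ := hb
  have hbez : (a : ℤ) * a.gcdA b + b * a.gcdB b = 1 := by
    rw [← Nat.gcd_eq_gcd_ab, hab.gcd_eq_one, Nat.cast_one]
  refine ⟨δ ^ a.gcdA b * γ ^ a.gcdB b, ?_⟩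
  have e1 : (δ ^ a.gcdA b) ^ (a * b) = α ^ (a * a.gcdA b) := by
    rw [← hδ, ← zpow_natCast, ← zpow_natCast, ← zpow_mul, ← zpow_mul]
    congr 1
    push_cast
    ring
  have e2 : (γ ^ a.gcdB b) ^ (a * b) = α ^ (b * a.gcdB b) := by
    rw [← hγ, ← zpow_natCast, ← zpow_natCast, ← zpow_mul, ← zpow_mul]
    congr 1
    push_cast
    ring
  rw [mul_pow, e1, e2, ← zpow_add₀ h0, hbez, zpow_one]

theorem exists_pow_eq_of_forall_prime {K : Type*} [Field K] {α : K} (h0 : α ≠ 0) (n : ℕ)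
    (hn : 0 < n) (h : ∀ p e : ℕ, p.Prime → 0 < e → p ^ e ∣ n → ∃ γ : K, γ ^ (p ^ e) = α) :
    ∃ γ : K, γ ^ n = α := by
  induction n using Nat.recOnPosPrimePosCoprime with
  | prime_pow p e hp he => exact h p e hp he dvd_rfl
  | zero => exact absurd hn (lt_irrefl 0)
  | one => exact ⟨α, pow_one α⟩
  | coprime a b ha hb hab iha ihb =>
    exact exists_pow_eq_mul_of_coprime h0 hab
      (iha (by omega) fun p e hp he hd => h p e hp he (hd.mul_right b))
      (ihb (by omega) fun p e hp he hd => h p e hp he (hd.mul_left a))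

theorem gcd_prime_pow_of_emultiplicity {p : ℕ} (hp : p.Prime) {z : ℤ} {q r : ℕ}
    (hz : emultiplicity (p : ℤ) z = q) (hqr : q ≤ r) : z.gcd (p ^ r : ℕ) = p ^ q := by
  obtain ⟨h1, h2⟩ := emultiplicity_eq_coe.1 hz
  obtain ⟨j, hj, hgj⟩ := (Nat.dvd_prime_pow hp).1
    (Int.natCast_dvd_natCast.1 (Int.gcd_dvd_right z (p ^ r : ℕ)))
  have hq : p ^ q ∣ z.gcd (p ^ r : ℕ) :=
    Int.dvd_gcd (by exact_mod_cast h1) (by exact_mod_cast pow_dvd_pow (p : ℤ) hqr)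
  rw [hgj] at hq ⊢
  have h3 : q ≤ j := (Nat.pow_dvd_pow_iff_le_right hp.one_lt).1 hq
  rcases h3.lt_or_eq with h | rfl
  · refine absurd ?_ h2
    have h4 : ((p ^ j : ℕ) : ℤ) ∣ z := hgj ▸ Int.gcd_dvd_left z (p ^ r : ℕ)
    push_cast at h4
    exact (pow_dvd_pow _ h).trans h4
  · rfl

theorem exists_coprime_not_dvd_pow_sub_one {p d n : ℕ} (hp : p.Prime) (hd : 0 < d)
    (hdp : d + 1 < p) (hn : ¬ p ∣ n) : ∃ x : ℕ, x.Coprime (p * n) ∧ ¬ (p : ℤ) ∣ (x : ℤ) ^ d - 1 := by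
  have : Fact p.Prime := ⟨hp⟩
  obtain ⟨y, hy⟩ : ∃ y : (ZMod p)ˣ, y ^ d ≠ 1 := by
    by_contra! h
    have h1 := Monoid.exponent_dvd_of_forall_pow_eq_one h
    rw [IsCyclic.exponent_eq_card, Nat.card_eq_fintype_card, ZMod.card_units_eq_totient,
      Nat.totient_prime hp] at h1
    have := Nat.le_of_dvd hd h1
    omega
  have hcop : p.Coprime n := (Nat.Prime.coprime_iff_not_dvd hp).2 hn
  obtain ⟨x, hx1, hx2⟩ := Nat.chineseRemainder hcop (y : ZMod p).val 1
  have hxy : (x : ZMod p) = y := by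
    rw [(ZMod.natCast_eq_natCast_iff _ _ _).2 hx1, ZMod.natCast_zmod_val]
  refine ⟨x, Nat.Coprime.mul_right ?_ ?_, ?_⟩
  · rw [Nat.coprime_comm, Nat.Prime.coprime_iff_not_dvd hp, ← ZMod.natCast_eq_zero_iff, hxy]
    exact y.ne_zero
  · exact (Nat.ModEq.gcd_eq hx2).trans (Nat.gcd_one_left n)
  · intro h
    rw [← ZMod.intCast_zmod_eq_zero_iff_dvd] at h
    push_cast at h
    rw [hxy, sub_eq_zero] at h
    exact hy (Units.ext (by push_cast; exact h))

theorem exists_prime_pow_eq_of_cyclotomic {K M : Type*} [Field K] [CharZero K] [Field M]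
    [Algebra K M] (hd : 0 < maxAbelianDegree ℚ K) {p r e n N : ℕ} (hNeq : N = p ^ r * n) (hp : p.Prime) (he : 0 < e)
    (hn : 0 < n) (hpn : ¬ p ∣ n) [IsCyclotomicExtension {N} K M]
    (hr : 2 + padicValNat p (maxAbelianDegree ℚ K) + e ≤ r ∨
      maxAbelianDegree ℚ K + 1 < p ∧ e ≤ r)
    {α : K} (h0 : α ≠ 0) {β : M} (hβ : β ^ p ^ r = algebraMap K M α) :
    ∃ γ : K, γ ^ p ^ e = α := by
  subst hNeq
  set d := maxAbelianDegree ℚ K with hdef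
  have hN : NeZero (p ^ r * n) := ⟨(Nat.mul_pos (pow_pos hp.pos r) hn).ne'⟩
  have : CharZero M := charZero_of_injective_algebraMap (algebraMap K M).injective
  have hgal : IsGalois K M := IsCyclotomicExtension.isGalois {p ^ r * n} K M
  have hζ := IsCyclotomicExtension.zeta_spec (p ^ r * n) K M
  set ζ := IsCyclotomicExtension.zeta (p ^ r * n) K M
  have hcomm : ∀ σ τ : M ≃ₐ[K] M, σ * τ = τ * σ := fun σ τ =>
    hζ.autToPow_injective (K := K)
      ((map_mul _ σ τ).trans ((mul_comm _ _).trans (map_mul _ τ σ).symm))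
  have hζP : IsPrimitiveRoot (ζ ^ n) (p ^ r) := hζ.pow (NeZero.pos _) (mul_comm _ _)
  have hP : 0 < p ^ r := pow_pos hp.pos r
  have hlift : ∀ s, e ≤ s → (∃ γ : K, γ ^ p ^ s = α) → ∃ γ : K, γ ^ p ^ e = α := by
    rintro s hs ⟨γ, hγ⟩
    exact ⟨γ ^ p ^ (s - e), by rw [← pow_mul, ← pow_add, Nat.sub_add_cancel hs, hγ]⟩
  rcases hr with hr | ⟨hdp, her⟩
  · set q := 2 + padicValNat p d with hq
    -- The square ensures `4 ∣ x - 1` when `p = 2`, as lifting the exponent requires; the factor `n`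
    -- makes `σ` trivial on `n`-th roots of unity. Then `x ^ d - 1` has valuation exactly `q`, `σ`
    -- is killed by `p ^ (r - q)`, and the geometric sum has valuation `r - q`.
    set x := 1 + p ^ 2 * n with hx
    have hxN : x.Coprime (p ^ r * n) := by
      refine Nat.Coprime.mul_right (Nat.Coprime.pow_right _ ?_) ?_
      · rw [hx, pow_two, mul_assoc, Nat.coprime_add_mul_left_left]
        exact Nat.coprime_one_left p
      · rw [hx, Nat.coprime_add_mul_right_left]
        exact Nat.coprime_one_left n
    obtain ⟨σ, hσ⟩ := exists_algEquiv_pow (K := K) hζ hxN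
    rw [← hdef] at hσ
    have hσP : ∀ η : M, η ^ p ^ r = 1 → σ η = η ^ x ^ d := fun η h =>
      hσ η (by rw [pow_mul, h, one_pow])
    have hx1 : (x : ℤ) - 1 = (p : ℤ) ^ 2 * n := by
      rw [hx]
      push_cast
      ring
    have hpx : (p : ℤ) ^ 2 ∣ (x : ℤ) - 1 := ⟨n, hx1⟩
    have hpx1 : (p : ℤ) ∣ (x : ℤ) - 1 := (dvd_pow_self _ two_ne_zero).trans hpx
    have hpx2 : p = 2 → (4 : ℤ) ∣ (x : ℤ) - 1 := by
      rintro rfl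
      exact hpx
    have hpZ : Prime (p : ℤ) := Nat.prime_iff_prime_int.1 hp
    have hm1 : emultiplicity (p : ℤ) ((x : ℤ) - 1) = 2 := by
      rw [hx1, emultiplicity_mul hpZ, emultiplicity_pow_self_of_prime hpZ,
        emultiplicity_eq_zero.2 (by exact_mod_cast hpn)]
      rfl
    have hmd : emultiplicity p d = padicValNat p d := by
      have : Fact p.Prime := ⟨hp⟩
      exact (padicValNat_eq_emultiplicity hd.ne').symm
    have hmu : emultiplicity (p : ℤ) (((x ^ d : ℕ) : ℤ) - 1) = q := by
      rw [Nat.cast_pow, emultiplicity_pow_sub_one hp hpx1 hpx2, hm1, hmd, hq]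
      push_cast
      rfl
    have hdvd : (x : ℤ) - 1 ∣ (((x ^ d : ℕ) : ℤ) - 1) := by
      simpa using sub_one_dvd_pow_sub_one (x : ℤ) d
    have hqr : q ≤ r := by omega
    have hmk : emultiplicity (p : ℤ) (((x ^ d : ℕ) : ℤ) ^ p ^ (r - q) - 1) = r := by
      rw [emultiplicity_pow_sub_one hp (hpx1.trans hdvd) (fun h => (hpx2 h).trans hdvd), hmu,
        emultiplicity_pow_self_of_prime hp.prime, ← Nat.cast_add, Nat.add_sub_cancel' hqr]
    have hS : ((∑ i ∈ Finset.range (p ^ (r - q)), (x ^ d) ^ i : ℕ) : ℤ) * (((x ^ d : ℕ) : ℤ) - 1) =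
        ((x ^ d : ℕ) : ℤ) ^ p ^ (r - q) - 1 := by
      rw [← geom_sum_mul]
      push_cast
      rfl
    have hmS : emultiplicity (p : ℤ) ((∑ i ∈ Finset.range (p ^ (r - q)), (x ^ d) ^ i : ℕ) : ℤ)
        = (r - q : ℕ) := by
      have h := hmk
      rw [← hS, emultiplicity_mul hpZ, hmu] at h
      have h2 : (r : ℕ∞) = ((r - q : ℕ) : ℕ∞) + q := by
        rw [← Nat.cast_add, Nat.sub_add_cancel hqr]
      rw [h2] at h
      exact ENat.add_left_injective_of_ne_top (ENat.natCast_ne_top q) h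
    have hone : σ ^ p ^ (r - q) = 1 := by
      have hpow : ∀ k : ℕ, (σ ^ k) ζ = ζ ^ (x ^ d) ^ k := by
        intro k
        induction k with
        | zero => simp
        | succ k ih => rw [pow_succ', AlgEquiv.mul_apply, ih, map_pow, hσ ζ hζ.pow_eq_one,
            ← pow_mul, pow_succ, mul_comm]
      have hmod : (x ^ d) ^ p ^ (r - q) ≡ 1 [MOD p ^ r * n] := by
        refine (Nat.modEq_iff_dvd.2 ?_).symm
        push_cast
        refine IsCoprime.mul_dvd ?_ ?_ ?_
        · exact_mod_cast Nat.isCoprime_iff_coprime.2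
            (Nat.Coprime.pow_left r ((Nat.Prime.coprime_iff_not_dvd hp).2 hpn))
        · have := pow_dvd_of_le_emultiplicity hmk.ge
          push_cast at this
          exact this
        · refine Dvd.dvd.trans ?_ (sub_one_dvd_pow_sub_one ((x : ℤ) ^ d) _)
          refine Dvd.dvd.trans ?_ (sub_one_dvd_pow_sub_one (x : ℤ) d)
          exact ⟨(p : ℤ) ^ 2, by rw [hx1, mul_comm]⟩
      have hfix : (σ ^ p ^ (r - q)) ζ = ζ := by
        rw [hpow, pow_eq_pow_of_modEq hmod hζ.pow_eq_one, pow_one]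
      have hid : ((σ ^ p ^ (r - q) : M ≃ₐ[K] M) : M →ₐ[K] M) = AlgHom.id K M :=
        (hζ.powerBasis K).algHom_ext (by rw [hζ.powerBasis_gen K]; exact hfix)
      exact AlgEquiv.ext fun y => DFunLike.congr_fun hid y
    have hPg : p ^ r / p ^ q = p ^ (r - q) := Nat.pow_div hqr hp.pos
    have hgS := gcd_prime_pow_of_emultiplicity hp hmS (Nat.sub_le r q)
    have key := exists_pow_eq_of_cyclotomic hcomm hP hζP h0 hβ hσP (g := p ^ q)
      (k := p ^ (r - q)) (gcd_prime_pow_of_emultiplicity hp hmu hqr)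
      (Or.inr ⟨hone, by
        rw [Int.gcd_natCast_natCast] at hgS
        rw [hPg, hgS]⟩)
    rw [hPg] at key
    exact hlift (r - q) (by omega) key
  -- For `p > d + 1` the exponent `x ^ d` can be chosen with `x ^ d - 1` prime to `p`, so nothing is
  -- lost in the descent.
  · obtain ⟨x, hxN, hx⟩ := exists_coprime_not_dvd_pow_sub_one hp hd hdp hpn
    have hxN' : x.Coprime (p ^ r * n) :=
      Nat.Coprime.mul_right ((Nat.Coprime.coprime_mul_right_right hxN).pow_right r)
        (Nat.Coprime.coprime_mul_left_right hxN)
    obtain ⟨σ, hσ⟩ := exists_algEquiv_pow (K := K) hζ hxN'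
    rw [← hdef] at hσ
    have hσP : ∀ η : M, η ^ p ^ r = 1 → σ η = η ^ x ^ d := fun η h =>
      hσ η (by rw [pow_mul, h, one_pow])
    have hm0 : emultiplicity (p : ℤ) (((x ^ d : ℕ) : ℤ) - 1) = (0 : ℕ) := by
      rw [Nat.cast_zero, emultiplicity_eq_zero]
      push_cast
      exact hx
    have key := exists_pow_eq_of_cyclotomic hcomm hP hζP h0 hβ hσP (g := 1) (k := 0)
      (by simpa using gcd_prime_pow_of_emultiplicity hp hm0 (Nat.zero_le r)) (Or.inl rfl)
    rw [Nat.div_one] at key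
    exact hlift r her key

/-- A bound for the Chevalley–Bass number of a field whose maximal abelian subfield has degree
`d`. -/
def chevalleyBassBound (d : ℕ) : ℕ := (d + 1).factorial ^ 2 * d

theorem chevalleyBassBound_mem_chevalleyBassSet {K : Type*} [Field K] [CharZero K]
    (hd : 0 < maxAbelianDegree ℚ K) :
    chevalleyBassBound (maxAbelianDegree ℚ K) ∈ chevalleyBassSet K := by
  set d := maxAbelianDegree ℚ K with hdef
  have hΛ : 0 < chevalleyBassBound d := Nat.mul_pos (pow_pos (Nat.factorial_pos _) 2) hd
  refine ⟨hΛ, ?_⟩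
  rintro n hn α ⟨β, hβ⟩
  rcases eq_or_ne α 0 with rfl | h0
  · exact ⟨0, zero_pow hn.ne'⟩
  refine exists_pow_eq_of_forall_prime h0 n hn fun p e hp he hpe => ?_
  have hN : 0 < chevalleyBassBound d * n := Nat.mul_pos hΛ hn
  have hN0 : NeZero (chevalleyBassBound d * n) := ⟨hN.ne'⟩
  have hNK : NeZero ((chevalleyBassBound d * n : ℕ) : K) := NeZero.charZero
  have hcyc : IsCyclotomicExtension {chevalleyBassBound d * n} K (CyclotomicField (chevalleyBassBound d * n) K) :=
    CyclotomicField.isCyclotomicExtension _ K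
  obtain ⟨r, n', hpn', hNr⟩ := Nat.exists_eq_pow_mul_and_not_dvd hN.ne' p hp.ne_one
  have hn' : 0 < n' := Nat.pos_of_mul_pos_left (hNr ▸ hN)
  have hβ' : (β ^ n') ^ p ^ r = algebraMap K _ α :=
    (pow_mul β n' (p ^ r)).symm.trans
      ((congrArg (β ^ ·) ((mul_comm _ _).trans hNr.symm)).trans hβ)
  have hle : ∀ s, p ^ s ∣ chevalleyBassBound d * n → s ≤ r := by
    intro s hs
    rw [hNr] at hs
    have hcop : (p ^ s).Coprime n' :=
      Nat.Coprime.pow_left s ((Nat.Prime.coprime_iff_not_dvd hp).2 hpn')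
    exact (Nat.pow_dvd_pow_iff_le_right hp.one_lt).1 (hcop.dvd_of_dvd_mul_right hs)
  refine exists_prime_pow_eq_of_cyclotomic hd hNr hp he hn' hpn' ?_ h0 hβ'
  rcases le_or_gt p (d + 1) with hpd | hpd
  · refine Or.inl (hle _ ?_)
    -- For `p ≤ d + 1` the three factors `p ^ 2`, `p ^ v_p(d)` and `p ^ e` divide `(d + 1)! ^ 2`,
    -- `d` and `n` respectively.
    rw [pow_add, pow_add]
    exact mul_dvd_mul (mul_dvd_mul (pow_dvd_pow_of_dvd ((Nat.Prime.dvd_factorial hp).2 hpd) 2)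
      pow_padicValNat_dvd) hpe
  · exact Or.inr ⟨hpd, hle e (hpe.mul_left _)⟩

/-! ### Denominators of primitive twisted rational zeros -/

theorem IsBinetExpansion.ne_zero {K : Type*} [Field K] {s : ℕ} {U : ℤ → K} {lam : Fin s → K}
    {f : Fin s → K[X]} (h : IsBinetExpansion U lam f) (i : Fin s) : lam i ≠ 0 := by
  obtain ⟨E, ⟨⟨hE, hc⟩, -⟩, -, hroot⟩ := h.exists_recurrence
  intro h0
  have h1 : E.charPoly.IsRoot 0 := (hroot 0).2 ⟨i, h0⟩
  rw [IsRoot.def, LinearRecurrence.charPoly, eval_sub, eval_finsetSum] at h1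
  simp only [eval_monomial, one_mul, zero_pow hE.ne', zero_sub, neg_eq_zero] at h1
  rw [Finset.sum_eq_single ⟨0, hE⟩] at h1
  · simp at h1
    exact hc h1
  · intro b _ hb
    have : (b : ℕ) ≠ 0 := fun h => hb (Fin.ext h)
    rw [zero_pow this, mul_zero]
  · simp

section TwistedZero

variable {K L : Type*} [Field K] [Field L] [Algebra K L] {s : ℕ} {lam : Fin s → K}
  {f : Fin s → K[X]} {a : ℚ} {ξ p : Fin s → L}

theorem IsRatPow.ne_zero {α x : L} (h : IsRatPow α a x) (h0 : α ≠ 0) : x ≠ 0 := by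
  obtain ⟨θ, hθ, rfl⟩ := h
  refine zpow_ne_zero _ ?_
  rintro rfl
  exact h0 (by rw [← hθ, zero_pow a.den_ne_zero])

theorem IsRatPow.pow_den {α x : L} (h : IsRatPow α a x) : x ^ a.den = α ^ a.num := by
  obtain ⟨θ, rfl, rfl⟩ := h
  rw [← zpow_natCast, ← zpow_natCast, ← zpow_mul, ← zpow_mul, mul_comm]

/-- The factors `σ (p i) / p i` are `a.den`-th roots of unity, hence fixed by `σ`, so the eigenvalue
principle makes them all equal. -/
theorem IsPrimitiveTwistedRationalZero.map_div_eq_self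
    (h : IsPrimitiveTwistedRationalZero lam f a ξ p) (h0 : ∀ i, lam i ≠ 0) (σ : L ≃ₐ[K] L)
    (hξ : ∀ i, σ (ξ i) = ξ i) (hσ : ∀ η : L, η ^ a.den = 1 → σ η = η) (i j : Fin s) :
    σ (p i / p j) = p i / p j := by
  have hlam : ∀ i, algebraMap K L (lam i) ≠ 0 := fun i => by simpa using h0 i
  have hp : ∀ i, p i ≠ 0 := fun i => (h.determination i).ne_zero (hlam i)
  have hpow : ∀ i, p i ^ a.den = algebraMap K L (lam i ^ a.num) := fun i => by
    rw [(h.determination i).pow_den, map_zpow₀]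
  have hχ : ∀ i, (σ (p i) / p i) ^ a.den = 1 := fun i => by
    rw [div_pow, ← map_pow, hpow, AlgEquiv.commutes, div_self]
    exact (_root_.map_ne_zero _).2 (zpow_ne_zero _ (h0 i))
  have key := eigenvalue_eq_of_minimal_sum (σ : L →+* L) (twistedTerm f a ξ p)
    (fun i => σ (p i) / p i) (fun i => ?_) (fun i => hσ _ (hχ i)) h.sum_eq_zero h.no_subsum i j
  · rw [div_eq_div_iff (hp i) (hp j)] at key
    have := map_ne_zero σ |>.2 (hp j)
    rw [map_div₀, div_eq_div_iff this (hp j), key, mul_comm]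
  · change σ (ξ i * algebraMap K L ((f i).eval (a : K)) * p i) =
      σ (p i) / p i * (ξ i * algebraMap K L ((f i).eval (a : K)) * p i)
    rw [map_mul, map_mul, AlgEquiv.commutes, hξ]
    field_simp [hp i]

theorem IsPrimitiveTwistedRationalZero.exists_pow_den_eq [CharZero K] [IsAlgClosure K L]
    (h : IsPrimitiveTwistedRationalZero lam f a ξ p) (h0 : ∀ i, lam i ≠ 0) {N : ℕ} (hN : 0 < N)
    (hξ : ∀ i, ξ i ^ N = 1) (hden : a.den ∣ N) {C : Type*} [Field C] [Algebra K C]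
    [IsCyclotomicExtension {N} K C] (i j : Fin s) :
    ∃ β : C, β ^ a.den = algebraMap K C (lam i / lam j) := by
  have hN0 : NeZero N := ⟨hN.ne'⟩
  have hLcl : IsAlgClosed L := IsAlgClosure.isAlgClosed K
  have hLalg : Algebra.IsAlgebraic K L := IsAlgClosure.isAlgebraic
  have hLgal : IsGalois K L := IsGalois.mk
  have hCalg : Algebra.IsAlgebraic K C :=
    (IsCyclotomicExtension.integral {N} K C).isAlgebraic
  let φ : C →ₐ[K] L := IsAlgClosed.lift
  have hζ := (IsCyclotomicExtension.zeta_spec N K C).map_of_injective φ.injective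
  have hroot : ∀ η : L, η ^ N = 1 → η ∈ φ.fieldRange := by
    intro η hη
    obtain ⟨k, -, rfl⟩ := hζ.eq_pow_of_pow_eq_one hη
    exact pow_mem (φ.mem_fieldRange.2 ⟨_, rfl⟩) k
  have hπ : p i / p j ∈ φ.fieldRange := by
    have h1 : p i / p j ∈ (⊥ : IntermediateField φ.fieldRange L) := by
      rw [InfiniteGalois.mem_bot_iff_fixed]
      intro σ
      have hσ : ∀ η : L, η ^ N = 1 → σ η = η := fun η hη => σ.commutes ⟨η, hroot η hη⟩
      refine h.map_div_eq_self h0 (σ.restrictScalars K) (fun i => hσ _ (hξ i)) (fun η hη => ?_) i j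
      obtain ⟨r, rfl⟩ := hden
      exact hσ η (by rw [pow_mul, hη, one_pow])
    obtain ⟨y, hy⟩ := IntermediateField.mem_bot.1 h1
    rw [← hy]
    exact y.2
  obtain ⟨π, hπ⟩ := φ.mem_fieldRange.1 hπ
  have hπpow : π ^ a.den = algebraMap K C ((lam i / lam j) ^ a.num) := by
    refine φ.injective (?_ : φ _ = φ _)
    rw [map_pow, hπ, AlgHom.commutes, div_pow, (h.determination i).pow_den,
      (h.determination j).pow_den, map_zpow₀, map_div₀, div_zpow]
  set α := lam i / lam j
  have hα0 : algebraMap K C α ≠ 0 := by simpa [α] using ⟨h0 i, h0 j⟩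
  -- `π` is an `a.den`-th root of `α ^ a.num`; since `a` is in lowest terms, Bézout produces a root
  -- of `α` itself.
  have hbez : a.num * a.num.gcdA a.den + a.den * a.num.gcdB a.den = 1 := by
    rw [← Int.gcd_eq_gcd_ab]
    exact_mod_cast a.reduced
  refine ⟨π ^ a.num.gcdA a.den * (algebraMap K C α) ^ a.num.gcdB a.den, ?_⟩
  calc (π ^ a.num.gcdA a.den * (algebraMap K C α) ^ a.num.gcdB a.den) ^ a.den
      = (π ^ a.den) ^ a.num.gcdA a.den * ((algebraMap K C α) ^ a.den) ^ a.num.gcdB a.den := by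
        rw [mul_pow, ← zpow_natCast, ← zpow_natCast, ← zpow_natCast, ← zpow_natCast, ← zpow_mul,
          ← zpow_mul, ← zpow_mul, ← zpow_mul, mul_comm (a.den : ℤ), mul_comm (a.den : ℤ)]
    _ = algebraMap K C α := by
        rw [hπpow, map_zpow₀, ← zpow_natCast, ← zpow_mul, ← zpow_mul, ← zpow_add₀ hα0, hbez,
          zpow_one]

theorem IsPrimitiveTwistedRationalZero.den_div_gcd_mem_kummerSet [CharZero K] [IsAlgClosure K L]
    (h : IsPrimitiveTwistedRationalZero lam f a ξ p) (h0 : ∀ i, lam i ≠ 0) {Λ : ℕ}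
    (hΛ : Λ ∈ chevalleyBassSet K) (i j : Fin s) :
    a.den / a.den.gcd Λ ∈ kummerSet (lam i / lam j) := by
  set α := lam i / lam j with hα
  have hα0 : α ≠ 0 := div_ne_zero (h0 i) (h0 j)
  -- The Chevalley–Bass property is used at `n = a.den * R`, so that `K(ζ_{Λn})` contains all the `ξ
  -- i`. It gives `α ^ (Λ * R) = γ ^ (a.den * R)`; the auxiliary `R` then only costs an `R`-th root
  -- of unity.
  set R := ∏ i, orderOf (ξ i)
  have hR : 0 < R := Finset.prod_pos fun i _ => (h.root_of_unity i).orderOf_pos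
  have hn : 0 < a.den * R := Nat.mul_pos a.den_pos hR
  have hN : 0 < Λ * (a.den * R) := Nat.mul_pos hΛ.1 hn
  have hN0 : NeZero (Λ * (a.den * R)) := ⟨hN.ne'⟩
  have hNK : NeZero ((Λ * (a.den * R) : ℕ) : K) := NeZero.charZero
  have hcyc : IsCyclotomicExtension {Λ * (a.den * R)} K (CyclotomicField (Λ * (a.den * R)) K) :=
    CyclotomicField.isCyclotomicExtension _ K
  obtain ⟨β, hβ⟩ := h.exists_pow_den_eq h0 hN
    (fun i => orderOf_dvd_iff_pow_eq_one.1
      (((Finset.dvd_prod_of_mem (fun i => orderOf (ξ i)) (Finset.mem_univ i)).mul_left _).mul_left _))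
    ((dvd_mul_right _ _).mul_left _) (C := CyclotomicField (Λ * (a.den * R)) K) i j
  have hβ' : β ^ (Λ * (a.den * R)) = (β ^ a.den) ^ (Λ * R) := by
    conv_rhs => rw [← pow_mul]
    exact congrArg (β ^ ·) (mul_left_comm _ _ _)
  obtain ⟨γ, hγ⟩ := hΛ.2 (a.den * R) hn (α ^ (Λ * R)) ⟨β, by
    rw [hβ', hβ, map_pow]⟩
  have hγ0 : γ ≠ 0 := by
    rintro rfl
    rw [zero_pow hn.ne'] at hγ
    exact pow_ne_zero _ hα0 hγ.symm
  refine div_gcd_mem_kummerSet (γ := γ) (ζ := α ^ Λ / γ ^ a.den) a.den_pos hα0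
    (isOfFinOrder_iff_pow_eq_one.2 ⟨R, hR, ?_⟩) ?_
  · rw [div_pow, ← pow_mul, ← pow_mul, hγ, div_self (pow_ne_zero _ hα0)]
  · rw [mul_div_cancel₀ _ (pow_ne_zero _ hγ0)]

theorem IsPrimitiveTwistedRationalZero.den_dvd [CharZero K] [IsAlgClosure K L]
    (h : IsPrimitiveTwistedRationalZero lam f a ξ p) (h0 : ∀ i, lam i ≠ 0)
    (hb : ∀ i j, i ≠ j → BddAbove (kummerSet (lam i / lam j))) {Λ : ℕ}
    (hΛ : Λ ∈ chevalleyBassSet K) : a.den ∣ Λ * kummerGcd lam := by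
  have h1 : a.den / a.den.gcd Λ ∣ kummerGcd lam := by
    refine Finset.dvd_gcd fun q hq => ?_
    have hq' : q.1 < q.2 := (Finset.mem_filter.1 hq).2
    exact dvd_kummerExponent (div_ne_zero (h0 _) (h0 _)) (hb _ _ hq'.ne)
      (h.den_div_gcd_mem_kummerSet h0 hΛ _ _)
  calc a.den = a.den.gcd Λ * (a.den / a.den.gcd Λ) :=
        (Nat.mul_div_cancel' (Nat.gcd_dvd_left _ _)).symm
    _ ∣ Λ * kummerGcd lam := mul_dvd_mul (Nat.gcd_dvd_right _ _) h1

theorem kummerGcd_pos (hs : 2 ≤ s) (hb : ∀ i j, i ≠ j → BddAbove (kummerSet (lam i / lam j))) :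
    0 < kummerGcd lam := by
  have hlt : (⟨0, by omega⟩ : Fin s) < ⟨1, by omega⟩ := by simp
  refine Nat.pos_of_dvd_of_pos (Finset.gcd_dvd (b := (⟨⟨0, by omega⟩, ⟨1, by omega⟩⟩ : Fin s × Fin s))
    (Finset.mem_filter.2 ⟨Finset.mem_univ _, hlt⟩)) ?_
  exact (kummerExponent_mem (hb _ _ hlt.ne)).1

end TwistedZero

/-! ### Orders of roots of unity in minimal vanishing sums -/

/-- For every `N` and every `x` coprime to `N`, some endomorphism fixing all the `c i` raises the
`N`-th roots of unity to the power `x ^ m`. -/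
def HasCyclotomicPowers {ι L : Type*} [Field L] (c : ι → L) (m : ℕ) : Prop :=
  ∀ N : ℕ, 0 < N → ∀ x : ℕ, x.Coprime N →
    ∃ σ : L →+* L, (∀ i, σ (c i) = c i) ∧ ∀ η : L, η ^ N = 1 → σ η = η ^ x ^ m

section MinimalSum

variable {ι L : Type*} [Fintype ι] [Field L] {c ζ : ι → L} {m Q : ℕ} {i₀ : ι}

/-- With `k = x ^ m - 1`, the eigenvalues are `ζ i ^ k`. The square hypothesis says that `σ` fixes
them, so all equal the one at `i₀`, which is `1`. -/
theorem dvd_pow_sub_one_of_dvd_sq (hc : HasCyclotomicPowers c m) (hsum : ∑ i, c i * ζ i = 0)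
    (hmin : ∀ I : Finset ι, I.Nonempty → I ≠ Finset.univ → ∑ i ∈ I, c i * ζ i ≠ 0)
    (hi₀ : ζ i₀ = 1) (hQ : 0 < Q) (hζ : ∀ i, ζ i ^ Q = 1)
    (hQmin : ∀ k : ℕ, (∀ i, ζ i ^ k = 1) → Q ∣ k) {x : ℕ} (hx : x.Coprime Q)
    (hsq : (Q : ℤ) ∣ ((x : ℤ) ^ m - 1) ^ 2) : (Q : ℤ) ∣ (x : ℤ) ^ m - 1 := by
  obtain ⟨σ, hσc, hσ⟩ := hc Q hQ x hx
  have hζ0 : ∀ i, ζ i ≠ 0 := fun i h => by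
    have := hζ i
    rw [h, zero_pow hQ.ne'] at this
    exact zero_ne_one this
  set k : ℤ := (x : ℤ) ^ m - 1 with hk
  have hzpow : ∀ η : L, η ≠ 0 → η ^ Q = 1 → σ η = η ^ k * η := by
    intro η h0 hη
    rw [hσ η hη, hk, zpow_sub₀ h0, zpow_one, div_mul_cancel₀ _ h0]
    exact_mod_cast (zpow_natCast η (x ^ m)).symm
  have hχQ : ∀ i, (ζ i ^ k) ^ Q = 1 := fun i => by
    rw [← zpow_natCast, ← zpow_mul, mul_comm, zpow_mul, zpow_natCast, hζ, one_zpow]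
  have hχk : ∀ i, (ζ i ^ k) ^ k = 1 := fun i => by
    obtain ⟨r, hr⟩ := hsq
    rw [← zpow_mul, ← pow_two, hr, zpow_mul, zpow_natCast, hζ, one_zpow]
  have hone : ∀ i, ζ i ^ k = 1 := fun i => by
    have := eigenvalue_eq_of_minimal_sum σ (fun i => c i * ζ i) (fun i => ζ i ^ k)
      (fun i => by rw [map_mul, hσc, hzpow _ (hζ0 i) (hζ i)]; ring)
      (fun i => by rw [hzpow _ (zpow_ne_zero _ (hζ0 i)) (hχQ i), hχk, one_mul]) hsum hmin i i₀
    rw [this, hi₀, one_zpow]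
  refine Int.natCast_dvd.2 (hQmin _ fun i => ?_)
  rw [← zpow_natCast]
  rcases abs_choice k with h | h <;> rw [Int.natCast_natAbs, h]
  · exact hone i
  · rw [zpow_neg, hone, inv_one]

/-- For `x = 1 + p ^ r * n` the valuation of `x ^ m - 1` at `p` is `r + v_p(m)`, one less than that
of `Q`, whereas its square is divisible by `Q`. -/
theorem no_large_prime_power (hm : 0 < m) {p r n : ℕ} (hp : p.Prime) (hr : 0 < r)
    (hr2 : p = 2 → 2 ≤ r) (hpn : ¬ p ∣ n) (hQ : Q = p ^ (r + padicValNat p m + 1) * n)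
    (h : ∀ x : ℕ, x.Coprime Q → (Q : ℤ) ∣ ((x : ℤ) ^ m - 1) ^ 2 → (Q : ℤ) ∣ (x : ℤ) ^ m - 1) :
    False := by
  have hpZ : Prime (p : ℤ) := Nat.prime_iff_prime_int.1 hp
  set v := padicValNat p m
  set x := 1 + p ^ r * n with hx
  have hxQ : x.Coprime Q := by
    rw [hQ]
    refine Nat.Coprime.mul_right (Nat.Coprime.pow_right _ ?_) ?_
    · obtain ⟨r', rfl⟩ : ∃ r', r = r' + 1 := ⟨r - 1, by omega⟩
      rw [hx, pow_succ', mul_assoc, Nat.coprime_add_mul_left_left]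
      exact Nat.coprime_one_left p
    · rw [hx, Nat.coprime_add_mul_right_left]
      exact Nat.coprime_one_left n
  have hx1 : (x : ℤ) - 1 = (p : ℤ) ^ r * n := by
    rw [hx]
    push_cast
    ring
  have hpx1 : (p : ℤ) ∣ (x : ℤ) - 1 := hx1 ▸ (dvd_pow_self _ hr.ne').mul_right _
  have hpx2 : p = 2 → (4 : ℤ) ∣ (x : ℤ) - 1 := by
    intro h2
    rw [hx1]
    have : (4 : ℤ) = (p : ℤ) ^ 2 := by rw [h2]; norm_num
    rw [this]
    exact (pow_dvd_pow _ (hr2 h2)).mul_right _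
  have hmx : emultiplicity (p : ℤ) ((x : ℤ) ^ m - 1) = (r + v : ℕ) := by
    have : Fact p.Prime := ⟨hp⟩
    rw [emultiplicity_pow_sub_one hp hpx1 hpx2, hx1, emultiplicity_mul hpZ,
      emultiplicity_pow_self_of_prime hpZ, emultiplicity_eq_zero.2 (by exact_mod_cast hpn),
      add_zero, ← padicValNat_eq_emultiplicity hm.ne', Nat.cast_add]
  obtain ⟨h1, h2⟩ := emultiplicity_eq_coe.1 hmx
  have hn : (n : ℤ) ∣ (x : ℤ) ^ m - 1 :=
    Dvd.dvd.trans ⟨(p : ℤ) ^ r, by rw [hx1, mul_comm]⟩ (sub_one_dvd_pow_sub_one (x : ℤ) m)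
  have h3 : (p : ℤ) ^ (r + v) * n ∣ (x : ℤ) ^ m - 1 := by
    refine IsCoprime.mul_dvd ?_ h1 hn
    exact_mod_cast Nat.isCoprime_iff_coprime.2
      (Nat.Coprime.pow_left (r + v) ((Nat.Prime.coprime_iff_not_dvd hp).2 hpn))
  refine h2 (Dvd.dvd.trans ?_ (h x hxQ (Dvd.dvd.trans ?_ (pow_dvd_pow_of_dvd h3 2))))
  · rw [hQ]
    push_cast
    exact dvd_mul_right _ _
  · rw [hQ]
    push_cast
    rw [mul_pow, ← pow_mul]
    exact mul_dvd_mul (pow_dvd_pow _ (by omega)) (dvd_pow_self _ two_ne_zero)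

/-- Dirichlet's box principle: at most `8 * m + 1` intervals of length `q = p / (4 * m)` cover the
residues, so two of the `p` multiples of `b` share a box. Shifting their difference by `q` makes all
the representatives nonnegative. -/
theorem exists_small_multiples {p m : ℕ} [Fact p.Prime] (hm : 0 < m)
    (hp : (8 * m + 1) ^ Fintype.card ι < p) (hpm : 8 * m + 1 ≤ p) (b : ι → ZMod p) :
    ∃ (t : ZMod p) (e : ι → ℕ), t ≠ 0 ∧ (∀ i, e i < 2 * (p / (4 * m))) ∧
      ∀ i, (e i : ZMod p) = t * b i + (p / (4 * m) : ℕ) := by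
  classical
  set q := p / (4 * m) with hq
  have hq0 : 0 < q := Nat.div_pos (by omega) (by omega)
  have hpq : p ≤ q * (8 * m + 1) := by
    have h1 := Nat.div_add_mod p (4 * m)
    have h2 := Nat.mod_lt p (show 0 < 4 * m by omega)
    rw [← hq] at h1
    nlinarith
  have hlt : ∀ z : ZMod p, z.val / q < 8 * m + 1 := fun z =>
    Nat.div_lt_of_lt_mul ((ZMod.val_lt z).trans_le hpq)
  let F : ZMod p → ι → Fin (8 * m + 1) := fun t i => ⟨(t * b i).val / q, hlt _⟩
  obtain ⟨t₁, t₂, hne, hF⟩ := Fintype.exists_ne_map_eq_of_card_lt F (by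
    rw [Fintype.card_fun, Fintype.card_fin, ZMod.card]
    exact hp)
  have hdiv : ∀ i, (t₁ * b i).val / q = (t₂ * b i).val / q := fun i =>
    congrArg Fin.val (congrFun hF i)
  have hbd : ∀ i, (t₁ * b i).val < (t₂ * b i).val + q ∧ (t₂ * b i).val < (t₁ * b i).val + q := by
    intro i
    have h1 := Nat.div_add_mod (t₁ * b i).val q
    have h2 := Nat.div_add_mod (t₂ * b i).val q
    have h3 := Nat.mod_lt (t₁ * b i).val hq0
    have h4 := Nat.mod_lt (t₂ * b i).val hq0
    rw [hdiv] at h1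
    omega
  refine ⟨t₁ - t₂, fun i => (t₁ * b i).val + q - (t₂ * b i).val, sub_ne_zero.2 hne, fun i => ?_,
    fun i => ?_⟩
  · have := hbd i
    change (t₁ * b i).val + q - (t₂ * b i).val < 2 * q
    omega
  · have := hbd i
    rw [Nat.cast_sub (by omega), Nat.cast_add, ZMod.natCast_zmod_val, ZMod.natCast_zmod_val]
    ring

open Classical in
theorem card_units_le_mul_card_image_pow {p m : ℕ} [Fact p.Prime] (hm : 0 < m) :
    p - 1 ≤ m * (Finset.univ.image fun y : (ZMod p)ˣ => y ^ m).card := by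
  have h1 : (Finset.univ : Finset (ZMod p)ˣ).card = p - 1 := by
    rw [Finset.card_univ, ZMod.card_units]
  rw [← h1]
  -- A nonempty fibre of the `m`-th power map is a coset of the `m`-torsion, which has at most `m`
  -- elements in a cyclic group.
  refine Finset.card_le_mul_card_image (f := fun y : (ZMod p)ˣ => y ^ m) _ m fun y hy => ?_
  obtain ⟨y₀, -, rfl⟩ := Finset.mem_image.1 hy
  refine le_trans (Finset.card_le_card_of_injOn (fun z => z * y₀⁻¹) (fun z hz => ?_)
    (fun z _ w _ h => mul_right_cancel h)) (IsCyclic.card_pow_eq_one_le (α := (ZMod p)ˣ) hm)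
  have hz' : z ^ m = y₀ ^ m := by simpa using hz
  simp [mul_pow, hz']

/-- A sparse polynomial in a `p`-th root of unity cannot vanish at all `m`-th power conjugates. -/
theorem not_dvd_of_card_lt (hm : 0 < m) (hc : HasCyclotomicPowers c m)
    (hsum : ∑ i, c i * ζ i = 0)
    (hmin : ∀ I : Finset ι, I.Nonempty → I ≠ Finset.univ → ∑ i ∈ I, c i * ζ i ≠ 0)
    (hi₀ : ζ i₀ = 1) (hQ : 0 < Q) (hζ : ∀ i, ζ i ^ Q = 1)
    (hQmin : ∀ k : ℕ, (∀ i, ζ i ^ k = 1) → Q ∣ k) {p n : ℕ} (hp : p.Prime) (hpn : ¬ p ∣ n)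
    (hQn : Q = p * n) (hpl : (8 * m + 1) ^ Fintype.card ι < p) : False := by
  classical
  have : Fact p.Prime := ⟨hp⟩
  have hn0 : 0 < n := Nat.pos_of_mul_pos_left (hQn ▸ hQ)
  have hcop : p.Coprime n := (Nat.Prime.coprime_iff_not_dvd hp).2 hpn
  have hζ0 : ∀ i, ζ i ≠ 0 := fun i h => by
    have := hζ i
    rw [h, zero_pow hQ.ne'] at this
    exact zero_ne_one this
  have hcard : 1 ≤ Fintype.card ι := Fintype.card_pos_iff.2 ⟨i₀⟩
  have hpm : 8 * m + 1 ≤ p := (Nat.le_self_pow (by omega) _).trans hpl.le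
  -- a primitive `p`-th root of unity
  obtain ⟨i₁, hi₁⟩ : ∃ i, ζ i ^ n ≠ 1 := by
    by_contra! h
    have := Nat.le_of_dvd hn0 (hQmin n h)
    have := hp.two_le
    nlinarith
  obtain ⟨ω, hω, hωp⟩ : ∃ ω : L, IsPrimitiveRoot ω p ∧ ω ^ p = 1 := by
    have hωp : (ζ i₁ ^ n) ^ p = 1 := by rw [← pow_mul, mul_comm, ← hQn, hζ]
    exact ⟨_, IsPrimitiveRoot.iff_orderOf.2 (orderOf_eq_prime hωp hi₁), hωp⟩
  have hbez : (p : ℤ) * p.gcdA n + n * p.gcdB n = 1 := by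
    rw [← Nat.gcd_eq_gcd_ab, hcop.gcd_eq_one, Nat.cast_one]
  set A := p.gcdA n
  set B := p.gcdB n
  let η : ι → L := fun i => (ζ i ^ p) ^ A
  have hη : ∀ i, η i ^ n = 1 := fun i => by
    change ((ζ i ^ p) ^ A) ^ n = 1
    rw [← zpow_natCast, ← zpow_mul, mul_comm, zpow_mul, zpow_natCast, ← pow_mul, ← hQn, hζ, one_zpow]
  have hb : ∀ i, ∃ b : ℕ, ω ^ b = (ζ i ^ n) ^ B := fun i => by
    obtain ⟨b, -, hb⟩ := hω.eq_pow_of_pow_eq_one (ξ := (ζ i ^ n) ^ B) (by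
      rw [← zpow_natCast, ← zpow_mul, mul_comm, zpow_mul, zpow_natCast, ← pow_mul, mul_comm n, ← hQn,
        hζ, one_zpow])
    exact ⟨b, hb⟩
  choose b hb using hb
  have hζη : ∀ i, ζ i = η i * ω ^ b i := fun i => by
    rw [hb]
    change ζ i = (ζ i ^ p) ^ A * (ζ i ^ n) ^ B
    rw [← zpow_natCast, ← zpow_natCast, ← zpow_mul, ← zpow_mul, ← zpow_add₀ (hζ0 i), hbez, zpow_one]
  obtain ⟨t, e, ht, heq, he⟩ := exists_small_multiples hm hpl hpm (fun i => (b i : ZMod p))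
  set q := p / (4 * m)
  -- replace `ω` by `ρ` with `ρ ^ t = ω`
  set ρ := ω ^ (t⁻¹).val
  have hρp : ρ ^ p = 1 := by rw [← pow_mul, mul_comm, pow_mul, hωp, one_pow]
  have hcast : ∀ {θ : L} {k l : ℕ}, θ ^ p = 1 → (k : ZMod p) = l → θ ^ k = θ ^ l := fun hθ h =>
    pow_eq_pow_of_modEq ((ZMod.natCast_eq_natCast_iff _ _ _).1 h) hθ
  have hρe : ∀ i, ρ ^ e i = ω ^ b i * ρ ^ q := fun i => by
    rw [← pow_mul, ← pow_mul, ← pow_add]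
    refine hcast hωp ?_
    push_cast
    rw [he, ZMod.natCast_zmod_val]
    field_simp
  have hρ : IsPrimitiveRoot ρ p := by
    refine hω.pow_of_coprime _ ?_
    rw [Nat.coprime_comm, Nat.Prime.coprime_iff_not_dvd hp, ← ZMod.natCast_eq_zero_iff,
      ZMod.natCast_zmod_val]
    exact inv_ne_zero ht
  have hρ0 : ρ ≠ 0 := hρ.ne_zero hp.ne_zero
  -- Up to the factor `ρ ^ q`, the value of `g` at `ρ` is the given sum. The common shift by `q`
  -- keeps the degree below `2 * q`.
  let g : L[X] := ∑ i, C (c i * η i) * X ^ e i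
  have hg0 : g ≠ 0 := by
    intro h
    -- Up to a factor `ω ^ b i₀`, this coefficient is a sub-sum of the given sum. By minimality it
    -- can vanish only if all `e i` agree, and then every `ζ i ^ n` is `1`, against the choice of
    -- `i₁`.
    have hco := congrArg (fun r : L[X] => r.coeff (e i₀)) h
    simp only [g, finsetSum_coeff, coeff_C_mul_X_pow, coeff_zero] at hco
    rw [← Finset.sum_filter] at hco
    have hb0 : ∀ i, e i₀ = e i → ω ^ b i = ω ^ b i₀ := fun i hi => by
      apply mul_right_cancel₀ (pow_ne_zero q hρ0)
      rw [← hρe, ← hρe, hi]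
    have hall : Finset.univ.filter (fun i => e i₀ = e i) = Finset.univ := by
      by_contra hne
      refine hmin _ ⟨i₀, by simp⟩ hne ?_
      calc ∑ i ∈ Finset.univ.filter (fun i => e i₀ = e i), c i * ζ i
          = ∑ i ∈ Finset.univ.filter (fun i => e i₀ = e i), (c i * η i) * ω ^ b i₀ :=
            Finset.sum_congr rfl fun i hi => by
              rw [hζη i, hb0 i (Finset.mem_filter.1 hi).2]
              ring
        _ = 0 := by rw [← Finset.sum_mul, hco, zero_mul]
    have hone : ∀ i, ζ i ^ n = 1 := fun i => by
      have hi := (Finset.ext_iff.1 hall i).2 (Finset.mem_univ i)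
      rw [hζη i, hb0 i (Finset.mem_filter.1 hi).2, hb i₀, hi₀, one_pow, one_zpow, mul_one, hη]
    exact hi₁ (hone i₁)
  have hdeg : g.natDegree ≤ 2 * q - 1 := by
    refine natDegree_sum_le_of_forall_le _ _ fun i _ => (natDegree_C_mul_X_pow_le _ _).trans ?_
    have := heq i
    omega
  have hgρ : g.eval ρ = 0 := by
    rw [eval_finsetSum]
    calc ∑ i, (C (c i * η i) * X ^ e i).eval ρ = ∑ i, (c i * ζ i) * ρ ^ q :=
          Finset.sum_congr rfl fun i _ => by
            rw [eval_mul, eval_C, eval_pow, eval_X, hρe, hζη i]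
            ring
      _ = 0 := by rw [← Finset.sum_mul, hsum, zero_mul]
  have hroots : ∀ y : (ZMod p)ˣ, g.IsRoot (ρ ^ ((y ^ m : (ZMod p)ˣ) : ZMod p).val) := by
    intro y
    -- With `x ≡ 1` modulo `n`, the endomorphism fixes the coefficients of `g` while moving its root
    -- `ρ` to `ρ ^ (y ^ m)`.
    obtain ⟨x, hx1, hx2⟩ := Nat.chineseRemainder hcop (y : ZMod p).val 1
    have hxy : (x : ZMod p) = y := by
      rw [(ZMod.natCast_eq_natCast_iff _ _ _).2 hx1, ZMod.natCast_zmod_val]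
    have hxQ : x.Coprime Q := by
      rw [hQn]
      refine Nat.Coprime.mul_right ?_ ((Nat.ModEq.gcd_eq hx2).trans (Nat.gcd_one_left n))
      rw [Nat.coprime_comm, Nat.Prime.coprime_iff_not_dvd hp, ← ZMod.natCast_eq_zero_iff, hxy]
      exact y.ne_zero
    obtain ⟨σ, hσc, hσ⟩ := hc Q hQ x hxQ
    have hση : ∀ i, σ (η i) = η i := fun i => by
      rw [hσ _ (by rw [hQn, mul_comm, pow_mul, hη, one_pow]),
        pow_eq_pow_of_modEq (hx2.pow m) (hη i), one_pow, pow_one]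
    have hσρ : σ ρ = ρ ^ ((y ^ m : (ZMod p)ˣ) : ZMod p).val := by
      rw [hσ _ (by rw [hQn, pow_mul, hρp, one_pow])]
      refine hcast hρp ?_
      rw [ZMod.natCast_zmod_val]
      push_cast
      rw [hxy]
    have hmap : g.map σ = g := by
      simp only [g, Polynomial.map_sum, Polynomial.map_mul, Polynomial.map_pow, map_C, map_X,
        map_mul, hσc, hση]
    rw [IsRoot.def, ← hσρ]
    conv_lhs => rw [← hmap]
    rw [eval_map_apply, hgρ, map_zero]
  have hcardS : (Finset.univ.image fun y : (ZMod p)ˣ => y ^ m).card ≤ g.natDegree := by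
    refine le_trans ?_ (card_roots' g)
    refine le_trans ?_ (Multiset.toFinset_card_le _)
    refine Finset.card_le_card_of_injOn (fun u => ρ ^ (u : ZMod p).val) (fun u hu => ?_)
      (fun u _ w _ h => ?_)
    · obtain ⟨y, -, rfl⟩ := Finset.mem_image.1 hu
      rw [Finset.mem_coe, Multiset.mem_toFinset, mem_roots hg0]
      exact hroots y
    · exact Units.ext (ZMod.val_injective p
        (hρ.pow_inj (ZMod.val_lt _) (ZMod.val_lt _) h))
  have h1 := card_units_le_mul_card_image_pow (p := p) hm
  have h2 : p - 1 ≤ m * (2 * q - 1) := h1.trans (Nat.mul_le_mul_left m (hcardS.trans hdeg))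
  have h3 : 4 * m * q ≤ p := Nat.mul_div_le p (4 * m)
  have h4 := hp.two_le
  have h5 : m * (2 * q - 1) = 2 * m * q - m := by
    rw [Nat.mul_sub, mul_one]
    ring_nf
  have h6 : 4 * m * q = 2 * (2 * m * q) := by ring
  rw [h5] at h2
  omega

/-- Every prime has valuation at most `2 + v_p(m)` in `Q`, where the `2` rather than `1` allows for
`p = 2`, and no prime above `(8 * m + 1) ^ card ι` divides `Q`. -/
theorem dvd_factorial_sq_mul (hm : 0 < m) (hc : HasCyclotomicPowers c m)
    (hsum : ∑ i, c i * ζ i = 0)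
    (hmin : ∀ I : Finset ι, I.Nonempty → I ≠ Finset.univ → ∑ i ∈ I, c i * ζ i ≠ 0)
    (hi₀ : ζ i₀ = 1) (hQ : 0 < Q) (hζ : ∀ i, ζ i ^ Q = 1)
    (hQmin : ∀ k : ℕ, (∀ i, ζ i ^ k = 1) → Q ∣ k) :
    Q ∣ ((8 * m + 1) ^ Fintype.card ι).factorial ^ 2 * m := by
  have hsq := fun (x : ℕ) (hx : x.Coprime Q) =>
    dvd_pow_sub_one_of_dvd_sq (x := x) hc hsum hmin hi₀ hQ hζ hQmin hx
  have hcard : 1 ≤ Fintype.card ι := Fintype.card_pos_iff.2 ⟨i₀⟩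
  have hY : 8 * m + 1 ≤ (8 * m + 1) ^ Fintype.card ι := Nat.le_self_pow (by omega) _
  refine (Nat.dvd_iff_prime_pow_dvd_dvd _ _).2 fun p k hp hk => ?_
  obtain ⟨E, n, hpn, hQE⟩ := Nat.exists_eq_pow_mul_and_not_dvd hQ.ne' p hp.ne_one
  have hkE : k ≤ E := by
    rw [hQE] at hk
    exact (Nat.pow_dvd_pow_iff_le_right hp.one_lt).1
      ((Nat.Coprime.pow_left k ((Nat.Prime.coprime_iff_not_dvd hp).2 hpn)).dvd_of_dvd_mul_right hk)
  rcases Nat.eq_zero_or_pos k with rfl | hk0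
  · simp
  have hE : E ≤ 2 + padicValNat p m := by
    by_contra! hlt
    refine no_large_prime_power (r := E - padicValNat p m - 1) hm hp (by omega) (fun _ => by omega)
      hpn ?_ hsq
    rw [hQE]
    congr 2
    omega
  have hpY : p ≤ (8 * m + 1) ^ Fintype.card ι := by
    by_contra! hlt
    have hpm : m < p := by omega
    have hv : padicValNat p m = 0 := padicValNat.eq_zero_of_not_dvd fun h => by
      have := Nat.le_of_dvd hm h
      omega
    have hE1 : E = 1 := by
      by_contra hne
      refine no_large_prime_power (r := E - padicValNat p m - 1) hm hp (by omega)
        (fun _ => by omega) hpn ?_ hsq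
      rw [hQE]
      congr 2
      omega
    rw [hE1, pow_one] at hQE
    exact not_dvd_of_card_lt hm hc hsum hmin hi₀ hQ hζ hQmin hp hpn hQE hlt
  refine (pow_dvd_pow p (hkE.trans hE)).trans ?_
  rw [pow_add]
  exact mul_dvd_mul (pow_dvd_pow_of_dvd ((Nat.Prime.dvd_factorial hp).2 hpY) 2) pow_padicValNat_dvd

theorem orderOf_div_le_of_minimal_sum (hm : 0 < m) (hc : HasCyclotomicPowers c m)
    (hsum : ∑ i, c i * ζ i = 0)
    (hmin : ∀ I : Finset ι, I.Nonempty → I ≠ Finset.univ → ∑ i ∈ I, c i * ζ i ≠ 0)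
    (hi₀ : ζ i₀ = 1) (hζ : ∀ i, IsOfFinOrder (ζ i)) (i j : ι) :
    orderOf (ζ i / ζ j) ≤ ((8 * m + 1) ^ Fintype.card ι).factorial ^ 2 * m := by
  set Q := Finset.univ.lcm fun i => orderOf (ζ i)
  have hdvd : ∀ i, orderOf (ζ i) ∣ Q := fun i => Finset.dvd_lcm (Finset.mem_univ i)
  have hQ : 0 < Q := by
    refine Nat.pos_of_ne_zero fun h => ?_
    obtain ⟨k, -, hk⟩ := Finset.lcm_eq_zero_iff.1 h
    exact (hζ k).orderOf_pos.ne' hk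
  have hpow : ∀ i, ζ i ^ Q = 1 := fun i => orderOf_dvd_iff_pow_eq_one.1 (hdvd i)
  have key := dvd_factorial_sq_mul hm hc hsum hmin hi₀ hQ hpow fun k hk =>
    Finset.lcm_dvd fun i _ => orderOf_dvd_of_pow_eq_one (hk i)
  have h1 : orderOf (ζ i / ζ j) ∣ Q := orderOf_dvd_of_pow_eq_one (by
    rw [div_pow, hpow, hpow, div_one])
  exact Nat.le_of_dvd (Nat.mul_pos (pow_pos (Nat.factorial_pos _) 2) hm) (h1.trans key)

end MinimalSum

/-! ### Automorphisms fixing radicals -/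

theorem exists_coprime_mul_modEq {N k x : ℕ} (hN : 0 < N) (hk : 0 < k) (hx : x.Coprime N) :
    ∃ y : ℕ, y.Coprime (N * k) ∧ y ≡ x [MOD N] := by
  have : NeZero N := ⟨hN.ne'⟩
  have : NeZero (N * k) := ⟨(Nat.mul_pos hN hk).ne'⟩
  obtain ⟨y, hy⟩ := ZMod.unitsMap_surjective (dvd_mul_right N k) (ZMod.unitOfCoprime x hx)
  refine ⟨(y : ZMod (N * k)).val, ZMod.val_coe_unit_coprime y, ?_⟩
  rw [← ZMod.natCast_eq_natCast_iff, ← ZMod.coe_unitOfCoprime x hx, ← hy, ZMod.unitsMap_val,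
    ZMod.natCast_val]

theorem hasCyclotomicPowers_of_pow_mem {K L : Type*} [Field K] [CharZero K] [Field L] [Algebra K L]
    [IsAlgClosure K L] {ι : Type*} (c : ι → L) (b : ι → K) (π : ι → L)
    (hc : ∀ i, c i = algebraMap K L (b i) * π i) {k m : ℕ} (hk : 0 < k) (hπ0 : ∀ i, π i ≠ 0)
    (hπ : ∀ i, ∃ α : K, π i ^ k = algebraMap K L α)
    (hm : maxAbelianDegree ℚ K * (k.totient * k) ∣ m) : HasCyclotomicPowers c m := by
  intro N hN x hx
  have hLcl : IsAlgClosed L := IsAlgClosure.isAlgClosed K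
  have hLalg : Algebra.IsAlgebraic K L := IsAlgClosure.isAlgebraic
  have hLgal : IsGalois K L := IsGalois.mk
  have : CharZero L := charZero_of_injective_algebraMap (algebraMap K L).injective
  -- `x` need not be prime to `k`, so it is first replaced by a congruent exponent that is; this
  -- gives control of the `k`-th roots of unity too.
  obtain ⟨y, hy, hyx⟩ := exists_coprime_mul_modEq hN hk hx
  have hNk : NeZero (N * k) := ⟨(Nat.mul_pos hN hk).ne'⟩
  have hNkL : NeZero ((N * k : ℕ) : L) := NeZero.charZero
  obtain ⟨ζ, hζ⟩ := HasEnoughRootsOfUnity.exists_primitiveRoot L (N * k)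
  obtain ⟨σ, hσ⟩ := exists_algEquiv_pow (K := K) hζ hy
  set d := maxAbelianDegree ℚ K
  obtain ⟨r, rfl⟩ := hm
  have hiter : ∀ j : ℕ, ∀ η : L, η ^ (N * k) = 1 → (σ ^ j) η = η ^ (y ^ (d * j)) := by
    intro j η hη
    induction j with
    | zero => simp
    | succ j ih =>
      rw [pow_succ', AlgEquiv.mul_apply, ih, map_pow, hσ η hη, ← pow_mul, ← pow_add, Nat.mul_succ,
        add_comm]
  have hyk : y ^ k.totient ≡ 1 [MOD k] := Nat.ModEq.pow_totient (Nat.Coprime.coprime_mul_left_right hy)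
  have hk1 : ∀ η : L, η ^ k = 1 → (σ ^ k.totient) η = η := fun η hη => by
    rw [hiter _ η (by rw [mul_comm, pow_mul, hη, one_pow]), mul_comm, pow_mul,
      pow_eq_pow_of_modEq (hyk.pow d) hη, one_pow, pow_one]
  -- `τ` fixes the `k`-th roots of unity, so its iterates act on `π i` through powers of one such
  -- root, and `τ ^ k` fixes `π i`. This accounts for the factor `k.totient * k` in `m`.
  set τ := σ ^ k.totient
  have hfix : ∀ i, (τ ^ k) (π i) = π i := by
    intro i
    obtain ⟨α, hα⟩ := hπ i
    have hα0 : algebraMap K L α ≠ 0 := hα ▸ pow_ne_zero k (hπ0 i)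
    have hχk : (τ (π i) / π i) ^ k = 1 := by
      rw [div_pow, ← map_pow, hα, AlgEquiv.commutes, div_self hα0]
    have hstep : ∀ j : ℕ, (τ ^ j) (π i) = (τ (π i) / π i) ^ j * π i := by
      intro j
      induction j with
      | zero => simp
      | succ j ih =>
        rw [pow_succ', AlgEquiv.mul_apply, ih, map_mul, map_pow, hk1 _ hχk, pow_succ, mul_assoc,
          div_mul_cancel₀ _ (hπ0 i)]
    rw [hstep, hχk, one_mul]
  have hfixr : ∀ i, ((τ ^ k) ^ r) (π i) = π i := by
    intro i
    induction r with
    | zero => simp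
    | succ r ih => rw [pow_succ', AlgEquiv.mul_apply, ih, hfix]
  refine ⟨(((τ ^ k) ^ r : L ≃ₐ[K] L) : L →+* L), fun i => ?_, fun η hη => ?_⟩
  · change ((τ ^ k) ^ r) (c i) = c i
    rw [hc, map_mul, AlgEquiv.commutes, hfixr]
  · change (((σ ^ k.totient) ^ k) ^ r) η = _
    rw [← pow_mul, ← pow_mul, hiter _ η (by rw [pow_mul, hη, one_pow])]
    refine pow_eq_pow_of_modEq ?_ hη
    rw [mul_assoc d, mul_assoc k.totient]
    exact hyx.pow _

/-! ### Explicit bounds -/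

/-- The bound for the denominator of a primitive twisted rational zero. -/
def denominatorBound (q : ℕ × ℕ) : ℕ := chevalleyBassBound q.1 * q.2

/-- The bound for the orders of the twisting roots of unity of a primitive twisted rational zero. -/
def orderBound (q : ℕ × ℕ × ℕ) : ℕ :=
  let m := q.1 * (denominatorBound (q.1, q.2.1)).factorial ^ 2
  ((8 * m + 1) ^ q.2.2).factorial ^ 2 * m

theorem primrec_factorial : Primrec Nat.factorial := by
  refine (Primrec.nat_rec₁ 1 (f := fun n x => (n + 1) * x) ?_).of_eq fun n => ?_
  · exact Primrec.nat_mul.comp (Primrec.succ.comp Primrec.fst) Primrec.snd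
  · induction n with
    | zero => rfl
    | succ n ih => rw [Nat.factorial_succ, ← ih]

theorem primrec_pow : Primrec₂ ((· ^ ·) : ℕ → ℕ → ℕ) := by
  refine (Primrec.nat_rec (f := fun _ : ℕ => 1) (g := fun (a : ℕ) (q : ℕ × ℕ) => q.2 * a)
    (Primrec.const 1) ?_).of_eq fun a n => ?_
  · exact Primrec.nat_mul.comp (Primrec.snd.comp Primrec.snd) Primrec.fst
  · induction n with
    | zero => rfl
    | succ n ih => rw [pow_succ, ← ih]

theorem primrec_denominatorBound : Primrec denominatorBound :=
  Primrec.nat_mul.comp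
    (Primrec.nat_mul.comp
      (primrec_pow.comp (primrec_factorial.comp (Primrec.succ.comp Primrec.fst)) (Primrec.const 2))
      Primrec.fst)
    Primrec.snd

theorem primrec_orderBound : Primrec orderBound := by
  have hm : Primrec fun q : ℕ × ℕ × ℕ => q.1 * (denominatorBound (q.1, q.2.1)).factorial ^ 2 :=
    Primrec.nat_mul.comp Primrec.fst
      (primrec_pow.comp (primrec_factorial.comp (primrec_denominatorBound.comp
        (Primrec.pair Primrec.fst (Primrec.fst.comp Primrec.snd)))) (Primrec.const 2))
  exact Primrec.nat_mul.comp
    (primrec_pow.comp (primrec_factorial.comp (primrec_pow.comp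
      (Primrec.succ.comp (Primrec.nat_mul.comp (Primrec.const 8) hm))
      (Primrec.snd.comp Primrec.snd))) (Primrec.const 2)) hm

/-- Dividing by `ξ j * p j` makes one root of unity equal to `1` and leaves coefficients that are
elements of `K` times the radicals `p k / p j`, whose `a.den`-th powers lie in `K`. -/
theorem IsPrimitiveTwistedRationalZero.orderOf_div_le {K L : Type*} [Field K] [CharZero K] [Field L]
    [Algebra K L] [IsAlgClosure K L] {s : ℕ} {lam : Fin s → K} {f : Fin s → K[X]} {a : ℚ}
    {ξ p : Fin s → L} (h : IsPrimitiveTwistedRationalZero lam f a ξ p) (h0 : ∀ i, lam i ≠ 0)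
    {m : ℕ} (hm : 0 < m) (hdm : maxAbelianDegree ℚ K * (a.den.totient * a.den) ∣ m) (i j : Fin s) :
    orderOf (ξ i / ξ j) ≤ ((8 * m + 1) ^ s).factorial ^ 2 * m := by
  have hlam : ∀ i, algebraMap K L (lam i) ≠ 0 := fun i => (_root_.map_ne_zero _).2 (h0 i)
  have hp : ∀ i, p i ≠ 0 := fun i => (h.determination i).ne_zero (hlam i)
  have hξ0 : ∀ i, ξ i ≠ 0 := fun i => (h.root_of_unity i).isUnit.ne_zero
  let c : Fin s → L := fun k => algebraMap K L ((f k).eval (a : K)) * (p k / p j)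
  let ζ : Fin s → L := fun k => ξ k / ξ j
  have hterm : ∀ k, c k * ζ k = (ξ j * p j)⁻¹ * twistedTerm f a ξ p k := fun k => by
    have h1 := hp j
    have h2 := hξ0 j
    simp only [c, ζ, twistedTerm]
    field_simp
  have hcyc : HasCyclotomicPowers c m := by
    refine hasCyclotomicPowers_of_pow_mem c (fun k => (f k).eval (a : K)) (fun k => p k / p j)
      (fun _ => rfl) a.den_pos (fun k => div_ne_zero (hp k) (hp j))
      (fun k => ⟨(lam k / lam j) ^ a.num, ?_⟩) hdm
    rw [div_pow, (h.determination k).pow_den, (h.determination j).pow_den, map_zpow₀, map_div₀,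
      div_zpow]
  have key := orderOf_div_le_of_minimal_sum (ζ := ζ) (i₀ := j) hm hcyc ?_ (fun I hI hne => ?_)
    (div_self (hξ0 j)) (fun k => ?_) i j
  · have hij : ζ i / ζ j = ξ i / ξ j := by
      simp only [ζ]
      rw [div_self (hξ0 j), div_one]
    rwa [hij, Fintype.card_fin] at key
  · simp_rw [hterm]
    rw [← Finset.mul_sum, h.sum_eq_zero, mul_zero]
  · simp_rw [hterm]
    rw [← Finset.mul_sum]
    exact mul_ne_zero (inv_ne_zero (mul_ne_zero (hξ0 j) (hp j))) (h.no_subsum I hI hne)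
  · change IsOfFinOrder (ξ k / ξ j)
    rw [div_eq_mul_inv]
    exact (h.root_of_unity k).mul (h.root_of_unity j).inv₀

theorem mainTheorem7 :
    ∃ (B : ℕ × ℕ → ℕ) (C : ℕ × ℕ × ℕ → ℕ), Computable B ∧ Computable C ∧
      ∀ (K : Type u) [Field K] [CharZero K] (L : Type v) [Field L] [Algebra K L]
        [IsAlgClosure K L], (⊤ : IntermediateField ℚ K).FG →
      ∀ (s : ℕ) (U : ℤ → K) (lam : Fin s → K) (f : Fin s → K[X]),
        2 ≤ s → IsBinetExpansion U lam f → IsNonDegenerate U lam →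
        -- `[K_ab : ℚ]`, the Chevalley–Bass number and the Kummer exponents are finite
        0 < maxAbelianDegree ℚ K ∧
        (chevalleyBassSet K).Nonempty ∧
        (∀ i j, i ≠ j → BddAbove (kummerSet (lam i / lam j))) ∧
        ∀ (a : ℚ) (ξ p : Fin s → L), IsPrimitiveTwistedRationalZero lam f a ξ p →
          a.den ∣ chevalleyBassNumber K * kummerGcd lam ∧
          a.den ≤ B (maxAbelianDegree ℚ K, kummerGcd lam) ∧
          ∀ i j, orderOf (ξ i / ξ j) ≤ C (maxAbelianDegree ℚ K, kummerGcd lam, s) := by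
  refine ⟨denominatorBound, orderBound, primrec_denominatorBound.to_comp,
    primrec_orderBound.to_comp, ?_⟩
  intro K _ _ L _ _ _ hfg s U lam f hs hU hnd
  have hd := maxAbelianDegree_pos_of_fg hfg
  have hmem := chevalleyBassBound_mem_chevalleyBassSet hd
  have h0 := hU.ne_zero
  have hb : ∀ i j, i ≠ j → BddAbove (kummerSet (lam i / lam j)) := fun i j hij =>
    bddAbove_kummerSet_of_fg hfg (div_ne_zero (h0 i) (h0 j)) (hnd.2 i j hij)
  refine ⟨hd, ⟨_, hmem⟩, hb, ?_⟩
  intro a ξ p h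
  have hΛ : chevalleyBassNumber K ∈ chevalleyBassSet K := Nat.sInf_mem ⟨_, hmem⟩
  have hρ := kummerGcd_pos hs hb
  have hdvd := h.den_dvd h0 hb hΛ
  have hle : a.den ≤ denominatorBound (maxAbelianDegree ℚ K, kummerGcd lam) :=
    (Nat.le_of_dvd (Nat.mul_pos hΛ.1 hρ) hdvd).trans (Nat.mul_le_mul_right _ (Nat.sInf_le hmem))
  -- The squared factorial in `orderBound` makes `m` depend only on `d` and `ρ`: both
  -- `a.den.totient` and `a.den` are at most the denominator bound, so each divides one copy of its
  -- factorial.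
  refine ⟨hdvd, hle, fun i j => h.orderOf_div_le h0
    (Nat.mul_pos hd (pow_pos (Nat.factorial_pos _) 2)) (mul_dvd_mul_left _ ?_) i j⟩
  rw [pow_two]
  exact mul_dvd_mul
    (Nat.dvd_factorial (Nat.totient_pos.2 a.den_pos) ((Nat.totient_le _).trans hle))
    (Nat.dvd_factorial a.den_pos hle)
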